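/- **Setting.** Let $(X,d)$ be a complete separable metric space and $d_L:X\times X\to[0,+\infty]$ a Borel distance (possibly infinite) such that: * any two points $x,y$ with $d_L(x,y)<\infty$ are joined by a $d_L$-geodesic. Here a $d_L$-geodesic is a map $\gamma:I\to X$ on an interval $I\subset\mathbb R$ (not necessarily closed or bounded) with $d_L(\gamma(s),\gamma(t))=|s-t|$ for all $s,t\in I$; * $d_L$ is non-branching: for $r\in[0,\infty)$ and $d_L(x,y)=r/2$ there is at most one $z$ with $d_L(x,z)=r$ and $d_L(y,z)=r/2$; * every $d_L$-geodesic is $d$-continuous and locally compact: for each $t\in I$ there is $r>0$ such that $\{s\in I: d(\gamma(s),\gamma(t))\le r\}$ is compact. Let $\mu,\nu$ be Borel probability measures on $X$ and let $\pi$ be a $d_L$-cyclically monotone transference plan between them. That is, $\pi$ has marginals $\mu,\nu$ and $\pi(\Gamma)=1$ for a Borel set $\Gamma\subset\{d_L<\infty\}$ such that $\sum_{i=0}^n d_L(x_i,y_i)\le\sum_{i=0}^n d_L(x_{i+1},y_i)$ for all $n\ge 0$ and all $(x_0,y_0),\dots,(x_n,y_n)\in\Gamma$, where $x_{n+1}=x_0$.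 Fix such a $\Gamma$. **Transport rays.** Let $\Gamma'$ be the set of $(x,y)$ for which there are $I\ge 0$ and $(w_i,z_i)\in\Gamma$, $i=0,\dots,I$, with $w_0=w_{I+1}=x$, $z_I=y$ and $\sum_{i=0}^I \big(d_L(w_{i+1},z_i)-d_L(w_i,z_i)\big)=0$. Put $$G=\{(x,y):\exists (w,z)\in\Gamma',\ d_L(w,x)+d_L(x,y)+d_L(y,z)=d_L(w,z)\},\qquad R=G\cup G^{-1}.$$ Let $\mathcal T_e$ be the set of $x$ such that $(x,y)\in R$ for some $y\ne x$. Let $\mathcal T$ be the set of $x$ such that $(y,x)\in G$ and $(x,z)\in G$ for some $y\neq x$ and $z\ne x$. A point $y$ is *initial* if $(y,x)\in G$ for some $x$ and no $w\neq y$ satisfies $(w,y)\in G$. It is *final* if $(x,y)\in G$ for some $x$ and no $w\ne y$ satisfies $(y,w)\in G$. A *$\mu$-measurable cross section* is a $\mu$-measurable map $f$ with $f(\mathcal T)\subset\mathcal T$, $(x,f(x))\in R$ for $x\in\mathcal T$, and $f(x)=f(y)$ whenever $x,y\in\mathcal T$ and $(x,y)\in R$. Given $f$, put $\mathcal S=f(\mathcal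 T)$. For $y\in\mathcal S$ and $t\ge0$ (respectively $t<0$) let $g(y,t)$ be the point $x$, if any, with $(y,x)\in G$ (respectively $(x,y)\in G$) and $d_L(x,y)=|t|$. For $A\subset X$ and $t\in\mathbb R$, the translate of $A$ by $t$ along the rays is $$A_t=g\big(g^{-1}(A)+(0,t)\big).$$ A *strongly consistent disintegration* of $\mu$ with respect to $f$ is a family $(\mu_y)$ of measures, with $m=f_\sharp\mu$, such that * $\mu_y$ is a Borel probability measure concentrated on $\mathcal T\cap f^{-1}(y)$ for every $y\in\mathcal S$; * $y\mapsto\mu_y(B)$ is $m$-measurable for every Borel $B$; * $\mu(B\cap f^{-1}(C))=\int_C\mu_y(B)\,m(dy)$ for all Borel $B,C$. **Theorem.** A $\mu$-measurable cross section exists. Let $f$ be any $\mu$-measurable cross section, and suppose that for every Borel set $A\subset X$ with $\mu(A)>0$ the set $\{t>0:\mu(A_t)>0\}$ is uncountable. Then: 1. $\mu(\mathcal T_e\setminus\mathcal T)=0$, and the set of initial and final points is $\mu$-negligible; 2. $\mu$ has a strongly consistent disintegration with respect to $f$; 3. for every such disintegration, for $m$-a.e. $y$ the conditional probability $\mu_y$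 has no atoms: $\mu_y(\{x\})=0$ for all $x\in X$. -/

import Mathlib

open MeasureTheory Set
open scoped ENNReal NNReal

/-! Geodesic structures `(X, d, d_L)` and the transport rays of a `d_L`-cyclically monotone set.

The ambient metric `d` is the one of `[MetricSpace X]`; the possibly infinite distance `d_L` is a
function `dL : X → X → ℝ≥0∞`. -/

/-- `γ`, restricted to the interval `I`, is a `d_L`-geodesic parametrized by arc length.
The interval `I` need not be closed or bounded. -/
def IsGeodesicOn {X : Type*} (dL : X → X → ℝ≥0∞) (I : Set ℝ) (γ : ℝ → X) : Prop :=
  I.OrdConnected ∧ ∀ s ∈ I, ∀ t ∈ I, dL (γ s) (γ t) = ENNReal.ofReal |s - t|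

/-- Non-branching: a geodesic from `x` to `y` has at most one prolongation beyond `y` of the same
length, that is, if `d_L(x,y) = r/2` then there is at most one `z` with `d_L(x,z) = r` and
`d_L(y,z) = r/2`. -/
def NonBranching {X : Type*} (dL : X → X → ℝ≥0∞) : Prop :=
  ∀ (r : ℝ≥0) (x y : X), dL x y = (r : ℝ≥0∞) / 2 →
    ({z | dL x z = (r : ℝ≥0∞)} ∩ {z | dL y z = (r : ℝ≥0∞) / 2}).Subsingleton

/-- The standing assumptions on `d_L`: it is a Borel distance with values in `[0, ∞]`, `(X, d_L)` is
a non-branching geodesic space, and its geodesics are `d`-continuous and locally compact in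
`(X, d)`. Two points at infinite distance are not required to be joined by a curve. -/
structure GeodesicStructure {X : Type*} [MetricSpace X] [MeasurableSpace X]
    (dL : X → X → ℝ≥0∞) : Prop where
  eq_zero_iff : ∀ x y, dL x y = 0 ↔ x = y
  symm : ∀ x y, dL x y = dL y x
  triangle : ∀ x y z, dL x z ≤ dL x y + dL y z
  borel : Measurable fun p : X × X => dL p.1 p.2
  geodesic : ∀ x y, dL x y < ∞ → ∃ γ : ℝ → X,
    IsGeodesicOn dL (Icc 0 (dL x y).toReal) γ ∧ γ 0 = x ∧ γ (dL x y).toReal = y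
  nonBranching : NonBranching dL
  continuous : ∀ (I : Set ℝ) (γ : ℝ → X), IsGeodesicOn dL I γ → ContinuousOn γ I
  locallyCompact : ∀ (I : Set ℝ) (γ : ℝ → X), IsGeodesicOn dL I γ → ∀ t ∈ I,
    ∃ r > 0, IsCompact (I ∩ γ ⁻¹' Metric.closedBall (γ t) r)

/-- `Γ` is `d_L`-cyclically monotone. Addition in `Fin (n + 1)` is cyclic, so that the index after
the last one is `0`. -/
def CyclicallyMonotone {X : Type*} (dL : X → X → ℝ≥0∞) (Γ : Set (X × X)) : Prop :=
  ∀ (n : ℕ) (x y : Fin (n + 1) → X), (∀ i, (x i, y i) ∈ Γ) →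
    ∑ i, dL (x i) (y i) ≤ ∑ i, dL (x (i + 1)) (y i)

/-- `π` is a transference plan between `μ` and `ν`. -/
def IsTransferencePlan {X : Type*} [MeasurableSpace X] (μ ν : Measure X)
    (π : Measure (X × X)) : Prop :=
  π.map Prod.fst = μ ∧ π.map Prod.snd = ν

/-- `Γ` is a Borel `d_L`-cyclically monotone set, contained in `{d_L < ∞}`, on which the plan `π`
is concentrated. -/
structure IsMonotoneCarrier {X : Type*} [MeasurableSpace X] (dL : X → X → ℝ≥0∞)
    (π : Measure (X × X)) (Γ : Set (X × X)) : Prop where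
  borel : MeasurableSet Γ
  concentrated : π Γᶜ = 0
  cyclicallyMonotone : CyclicallyMonotone dL Γ
  finite : ∀ p ∈ Γ, dL p.1 p.2 < ∞

section Rays

variable {X : Type*} (dL : X → X → ℝ≥0∞) (Γ : Set (X × X))

/-- The set `Γ'` of pairs `(x, y)` that are the first and the last point of a cycle of `Γ` of total
cost zero. All the distances of pairs in `Γ` being finite, the condition
`∑ (d_L(w_{i+1}, z_i) - d_L(w_i, z_i)) = 0` is written without subtractions. -/
def zeroCycles : Set (X × X) :=
  {p | ∃ (n : ℕ) (w z : Fin (n + 1) → X), (∀ i, (w i, z i) ∈ Γ) ∧ w 0 = p.1 ∧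
    z (Fin.last n) = p.2 ∧ ∑ i, dL (w (i + 1)) (z i) = ∑ i, dL (w i) (z i)}

/-- The set `G` of oriented transport rays. -/
def orientedRays : Set (X × X) :=
  {p | ∃ q ∈ zeroCycles dL Γ, dL q.1 p.1 + dL p.1 p.2 + dL p.2 q.2 = dL q.1 q.2}

/-- The set `R = G ∪ G⁻¹` of transport rays. -/
def rays : Set (X × X) :=
  {p | (p.1, p.2) ∈ orientedRays dL Γ ∨ (p.2, p.1) ∈ orientedRays dL Γ}

/-- The transport set without end points `𝒯`. -/
def transportSet : Set X :=
  {x | (∃ y, (y, x) ∈ orientedRays dL Γ ∧ y ≠ x) ∧ ∃ y, (x, y) ∈ orientedRays dL Γ ∧ y ≠ x}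

/-- The transport set with end points `𝒯ₑ`. -/
def transportSetWithEnds : Set X :=
  {x | (∃ y, (y, x) ∈ orientedRays dL Γ ∧ y ≠ x) ∨ ∃ y, (x, y) ∈ orientedRays dL Γ ∧ y ≠ x}

/-- The end point graph `a`: pairs `(x, y) ∈ G⁻¹` with `G⁻¹(y) \ {y} = ∅`. -/
def initialGraph : Set (X × X) :=
  {p | (p.2, p.1) ∈ orientedRays dL Γ ∧ {w | (w, p.2) ∈ orientedRays dL Γ} \ {p.2} = ∅}

/-- The end point graph `b`: pairs `(x, y) ∈ G` with `G(y) \ {y} = ∅`. -/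
def finalGraph : Set (X × X) :=
  {p | (p.1, p.2) ∈ orientedRays dL Γ ∧ {w | (p.2, w) ∈ orientedRays dL Γ} \ {p.2} = ∅}

/-- The set `P₂(a)` of initial points. -/
def initialPoints : Set X := Prod.snd '' initialGraph dL Γ

/-- The set `P₂(b)` of final points. -/
def finalPoints : Set X := Prod.snd '' finalGraph dL Γ

/-- The graph of the ray map `g` based on the set `S`, as a set of triples `(y, t, x)`: the point `x`
lies on the ray of `y ∈ S`, at the signed `d_L`-distance `t` from `y`. -/
def rayMap (S : Set X) : Set (X × ℝ × X) :=
  {p | p.1 ∈ S ∧ 0 ≤ p.2.1 ∧ (p.1, p.2.2) ∈ orientedRays dL Γ ∧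
      dL p.2.2 p.1 = ENNReal.ofReal p.2.1} ∪
  {p | p.1 ∈ S ∧ p.2.1 < 0 ∧ (p.2.2, p.1) ∈ orientedRays dL Γ ∧
      dL p.2.2 p.1 = ENNReal.ofReal (-p.2.1)}

/-- The translation `A_t = g(g⁻¹(A) + (0, t))` of `A` along the transport rays. -/
def evolution (S A : Set X) (t : ℝ) : Set X :=
  {x' | ∃ (y : X) (s : ℝ) (x : X), x ∈ A ∧ (y, s, x) ∈ rayMap dL Γ S ∧
    (y, s + t, x') ∈ rayMap dL Γ S}

/-- `f` restricts to a `μ`-measurable cross section `𝒯 → 𝒯` of the equivalence relation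
`R ∩ (𝒯 × 𝒯)`: it selects one point in each equivalence class. Its values outside `𝒯` are
irrelevant. -/
structure IsCrossSection [MeasurableSpace X] (μ : Measure X) (f : X → X) : Prop where
  aemeasurable : AEMeasurable f μ
  mem : ∀ x ∈ transportSet dL Γ, f x ∈ transportSet dL Γ
  mem_rays : ∀ x ∈ transportSet dL Γ, (x, f x) ∈ rays dL Γ
  eq_of_rays : ∀ x ∈ transportSet dL Γ, ∀ y ∈ transportSet dL Γ, (x, y) ∈ rays dL Γ → f x = f y

end Rays

/-- `y ↦ κ y`, `y ∈ f(T)`, is a disintegration of `μ`, strongly consistent with `f : T → f(T)`: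
`μ = ∫ κ_y m(dy)` with `m = f_♯ μ`, and each `κ_y` is a probability measure concentrated on the
fibre `T ∩ f⁻¹(y)`. -/
structure IsDisintegration {X : Type*} [MeasurableSpace X] (μ : Measure X) (T : Set X)
    (f : X → X) (κ : X → Measure X) : Prop where
  prob : ∀ y ∈ f '' T, IsProbabilityMeasure (κ y)
  aemeasurable : ∀ B, MeasurableSet B → AEMeasurable (fun y => κ y B) (μ.map f)
  consistent : ∀ B C, MeasurableSet B → MeasurableSet C →
    μ (B ∩ f ⁻¹' C) = ∫⁻ y in C, κ y B ∂(μ.map f)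
  strong : ∀ y ∈ f '' T, κ y (T ∩ f ⁻¹' {y})ᶜ = 0

/-! The geometry is condensed into four properties of `G`, called `IsRayOrder`: finiteness of `dL`,
transitivity, additivity, and closure under intermediate points. Transitivity and additivity come
from cyclical monotonicity: zero-cost cycles can be spliced (`zeroCycles_splice`), and the equality
case of the triangle inequalities puts the outer points on one ray. Non-branching then makes any two
points on the ray of an interior point comparable, so `R` is an equivalence relation on the
transport set and each class is parametrized by an interval.

Cross section: `G` is analytic, hence universally measurable. For each ball of a countable family, a
point in the closure of (ray ∩ ball) is chosen measurably and depending on that set alone. Local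
compactness of geodesics makes some such intersection nonempty and closed, so some choice lies on
the ray; the first such choice is taken.

Measure: the engine is `measure_eq_zero_of_card_le`. If almost every point lies in at most `N`
forward translates of `A`, the sum of the measures of these translates is at most `N`, so only
countably many are non-null, and the hypothesis forces `A` to be null. Points without successor have
no forward translates (`N = 0`); points without predecessor occur at most once per ray (`N = 1`);
atoms of mass above `1/(n+1)` occur at most `n+1` times per ray. The first two cases show that
almost every point is interior. The last excludes atoms of the regular conditional probability given
`f`, with which every disintegration agrees almost everywhere. -/

/-! ### Universal measurability of analytic sets; families of bounded multiplicity. -/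

section MeasureTheoryPreliminaries

open Filter Topology

/-- If all finite prefixes of `b : ℕ → ℕ` bound a sequence whose image under the continuous map `f`
is close to `y`, then `y` is the image of a sequence bounded by `b`. -/
theorem iInter_closure_image_subset {X : Type*} [MetricSpace X] {f : (ℕ → ℕ) → X}
    (hf : Continuous f) (b : ℕ → ℕ) :
    ⋂ k : ℕ, closure (f '' {x | ∀ i < k, x i ≤ b i}) ⊆ f '' {x | ∀ i, x i ≤ b i} := by
  intro y hy
  rw [mem_iInter] at hy
  have h1 : ∀ k : ℕ, ∃ x : ℕ → ℕ, (∀ i < k, x i ≤ b i) ∧ dist y (f x) < 1 / ((k : ℝ) + 1) := by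
    intro k
    obtain ⟨_, ⟨x, hx, rfl⟩, hd⟩ := Metric.mem_closure_iff.1 (hy k) (1 / ((k : ℝ) + 1))
      (by positivity)
    exact ⟨x, hx, hd⟩
  choose x hx hd using h1
  have hK : IsCompact {x : ℕ → ℕ | ∀ i, x i ≤ b i} := by
    have : {x : ℕ → ℕ | ∀ i, x i ≤ b i} = Set.pi univ fun i => Iic (b i) := by
      ext x; simp [Pi.le_def]
    rw [this]
    exact isCompact_univ_pi fun i => (finite_Iic (b i)).isCompact
  -- Truncating by `b` puts the sequences in the compact box; coordinate `i` is unchanged once `k >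
  -- i`, so the limit along the subsequence is the same.
  obtain ⟨z, hz, φ, hφ, hlim⟩ := hK.tendsto_subseq (x := fun k i => min (x k i) (b i))
    fun k i => min_le_right _ _
  refine ⟨z, hz, ?_⟩
  have hlim' : Tendsto (fun k => x (φ k)) atTop (𝓝 z) := by
    rw [tendsto_pi_nhds] at hlim ⊢
    intro i
    refine (hlim i).congr' ?_
    filter_upwards [eventually_gt_atTop i] with k hk
    exact min_eq_left (hx _ i (hk.trans_le (hφ.id_le k)))
  have h2 : Tendsto (fun k => f (x (φ k))) atTop (𝓝 (f z)) := (hf.tendsto z).comp hlim'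
  have h3 : Tendsto (fun k => f (x (φ k))) atTop (𝓝 y) := by
    rw [tendsto_iff_dist_tendsto_zero]
    refine squeeze_zero (fun _ => dist_nonneg) (fun k => ?_)
      (tendsto_one_div_add_atTop_nhds_zero_nat (𝕜 := ℝ) |>.comp hφ.tendsto_atTop)
    rw [dist_comm]
    exact (hd _).le
  exact tendsto_nhds_unique h2 h3

/-- Inner regularity of analytic sets. -/
theorem MeasureTheory.AnalyticSet.exists_measurableSet_subset {X : Type*} [MetricSpace X]
    [MeasurableSpace X] [BorelSpace X] (μ : Measure X) [IsFiniteMeasure μ] {s : Set X}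
    (hs : AnalyticSet s) {c : ℝ≥0∞} (hc : c < μ s) :
    ∃ K ⊆ s, MeasurableSet K ∧ c ≤ μ K := by
  rw [AnalyticSet] at hs
  rcases hs with rfl | ⟨f, hf, rfl⟩
  · simp at hc
  have step : ∀ (k : ℕ) (A : Set (ℕ → ℕ)), ∃ n : ℕ,
      c < μ (f '' A) → c < μ (f '' (A ∩ {x | x k ≤ n})) := by
    intro k A
    by_cases h : c < μ (f '' A)
    · have hU : f '' A = ⋃ n : ℕ, f '' (A ∩ {x | x k ≤ n}) := by
        rw [← image_iUnion, ← inter_iUnion]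
        congr 1
        ext x
        simp only [mem_inter_iff, mem_iUnion, mem_ofPred_eq, iff_self_and]
        exact fun _ => ⟨x k, le_rfl⟩
      have hmono : Monotone fun n : ℕ => f '' (A ∩ {x | x k ≤ n}) := fun m n hmn =>
        image_mono (inter_subset_inter_right _ fun x (hx : x k ≤ m) => hx.trans hmn)
      rw [hU, hmono.measure_iUnion, lt_iSup_iff] at h
      obtain ⟨n, hn⟩ := h
      exact ⟨n, fun _ => hn⟩
    · exact ⟨0, fun h' => absurd h' h⟩
  choose n hn using step
  -- One coordinate is bounded at a time, each bound being so large that the image keeps measure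
  -- above `c`.
  let A : ℕ → Set (ℕ → ℕ) := fun k => Nat.rec univ (fun k A => A ∩ {x | x k ≤ n k A}) k
  have hA : ∀ k, A (k + 1) = A k ∩ {x | x k ≤ n k (A k)} := fun k => rfl
  have hAc : ∀ k, c < μ (f '' A k) := by
    intro k
    induction k with
    | zero => simpa [A] using hc
    | succ k ih => rw [hA]; exact hn k _ ih
  have hAb : ∀ k, A k = {x | ∀ i < k, x i ≤ n i (A i)} := by
    intro k
    induction k with
    | zero => simp [A]
    | succ k ih =>
      rw [hA]
      ext x
      constructor
      · rintro ⟨h1, h2⟩ i hi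
        rcases Nat.lt_succ_iff_lt_or_eq.1 hi with h | rfl
        · rw [ih] at h1; exact h1 i h
        · exact h2
      · intro h
        refine ⟨?_, h k (Nat.lt_succ_self k)⟩
        rw [ih]
        exact fun i hi => h i (Nat.lt_succ_of_lt hi)
  refine ⟨⋂ k, closure (f '' A k), ?_, MeasurableSet.iInter fun k => isClosed_closure.measurableSet,
    ?_⟩
  · have := iInter_closure_image_subset hf fun i => n i (A i)
    simp_rw [← hAb] at this
    exact this.trans (image_subset_range _ _)
  · have hanti : Antitone fun k => closure (f '' A k) := by
      refine antitone_nat_of_succ_le fun k => closure_mono (image_mono ?_)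
      rw [hA]
      exact inter_subset_left
    refine ge_of_tendsto' (tendsto_measure_iInter_atTop
      (fun k => isClosed_closure.measurableSet.nullMeasurableSet) hanti
      ⟨0, measure_ne_top μ _⟩) fun k => ?_
    exact (hAc k).le.trans (measure_mono subset_closure)

/-- Analytic sets are universally measurable. -/
theorem MeasureTheory.AnalyticSet.nullMeasurableSet {X : Type*} [MetricSpace X]
    [MeasurableSpace X] [BorelSpace X] (μ : Measure X) [IsFiniteMeasure μ] {s : Set X}
    (hs : AnalyticSet s) : NullMeasurableSet s μ := by
  rcases eq_or_ne (μ s) 0 with h0 | h0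
  · exact NullMeasurableSet.of_null h0
  obtain ⟨u, -, hu, hlim⟩ := exists_seq_strictMono_tendsto' (pos_iff_ne_zero.2 h0)
  have hK := fun k => hs.exists_measurableSet_subset μ (hu k).2
  choose K hKs hKm hKc using hK
  have hsub : ⋃ k, K k ⊆ s := iUnion_subset hKs
  have hle : μ s ≤ μ (⋃ k, K k) :=
    le_of_tendsto' hlim fun k => (hKc k).trans (measure_mono (subset_iUnion K k))
  have hm : MeasurableSet (⋃ k, K k) := MeasurableSet.iUnion hKm
  exact hm.nullMeasurableSet.congr
    (ae_eq_of_subset_of_measure_ge hsub hle hm.nullMeasurableSet (measure_ne_top μ s))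

theorem MeasureTheory.AnalyticSet.inter {X : Type*} [TopologicalSpace X] [T2Space X] {s t : Set X}
    (hs : AnalyticSet s) (ht : AnalyticSet t) : AnalyticSet (s ∩ t) := by
  rw [inter_eq_iInter]
  exact AnalyticSet.iInter fun b => by cases b <;> assumption

theorem MeasureTheory.AnalyticSet.union {X : Type*} [TopologicalSpace X] {s t : Set X}
    (hs : AnalyticSet s) (ht : AnalyticSet t) : AnalyticSet (s ∪ t) := by
  rw [union_eq_iUnion]
  exact AnalyticSet.iUnion fun b => by cases b <;> assumption

/-- The preimage of an analytic set under an almost everywhere measurable map. -/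
theorem MeasureTheory.AnalyticSet.nullMeasurableSet_preimage {X Y : Type*} [MetricSpace X]
    [MeasurableSpace X] [BorelSpace X] [MetricSpace Y] [MeasurableSpace Y] [BorelSpace Y]
    {μ : Measure X} [IsFiniteMeasure μ] {s : Set Y} (hs : AnalyticSet s) {f : X → Y}
    (hf : AEMeasurable f μ) : NullMeasurableSet (f ⁻¹' s) μ := by
  obtain ⟨t, hts, htm, hte⟩ :=
    (hs.nullMeasurableSet (μ.map f)).exists_measurable_subset_ae_eq
  have h1 : NullMeasurableSet (f ⁻¹' t) μ := hf.nullMeasurable htm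
  have h2 : μ.map f (s \ t) = 0 := (ae_le_set.1 hte.symm.le)
  refine h1.congr ?_
  have h3 : ∀ᵐ x ∂μ, f x ∉ s \ t := ae_of_ae_map hf (measure_eq_zero_iff_ae_notMem.1 h2)
  filter_upwards [h3] with x hx
  refine propext ⟨fun h => hts h, fun h => ?_⟩
  by_contra hxt
  exact hx ⟨h, hxt⟩

/-- A family of sets, finitely many of which contain any given point up to a uniform bound, has only
countably many members of positive measure. -/
theorem countable_measure_pos_of_card_le {X ι : Type*} [MeasurableSpace X] {μ : Measure X}
    [IsFiniteMeasure μ] {E : ι → Set X} (hE : ∀ i, NullMeasurableSet (E i) μ) (N : ℕ)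
    (hN : ∀ᵐ x ∂μ, ∀ F : Finset ι, (∀ i ∈ F, x ∈ E i) → F.card ≤ N) :
    {i | 0 < μ (E i)}.Countable := by
  classical
  -- Integrating the number of sets that contain a point gives total measure at most `N * μ univ`; a
  -- convergent sum has countable support.
  have hsum : ∑' i, μ (E i) ≠ ∞ := by
    refine ne_top_of_le_ne_top (ENNReal.mul_ne_top (ENNReal.natCast_ne_top N)
      (measure_ne_top μ univ)) (?_ : _ ≤ (N : ℝ≥0∞) * μ univ)
    rw [ENNReal.tsum_eq_iSup_sum]
    refine iSup_le fun F => ?_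
    calc ∑ i ∈ F, μ (E i) = ∑ i ∈ F, ∫⁻ x, (E i).indicator 1 x ∂μ :=
          Finset.sum_congr rfl fun i _ => (lintegral_indicator_one₀ (hE i)).symm
      _ = ∫⁻ x, ∑ i ∈ F, (E i).indicator 1 x ∂μ :=
          (lintegral_finsetSum' _ fun i _ => aemeasurable_const.indicator₀ (hE i)).symm
      _ ≤ ∫⁻ _, (N : ℝ≥0∞) ∂μ := by
          refine lintegral_mono_ae ?_
          filter_upwards [hN] with x hx
          have := hx (F.filter fun i => x ∈ E i) fun i hi => (Finset.mem_filter.1 hi).2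
          calc ∑ i ∈ F, (E i).indicator (1 : X → ℝ≥0∞) x
              = ((F.filter fun i => x ∈ E i).card : ℝ≥0∞) := by
                simp [Set.indicator_apply]
            _ ≤ N := by exact_mod_cast this
      _ = (N : ℝ≥0∞) * μ univ := lintegral_const _
  convert Summable.countable_support_ennreal hsum using 1
  ext i
  simp [pos_iff_ne_zero]

end MeasureTheoryPreliminaries

/-! ### Measurable selection from the closure of a set. -/

section Selection

/-- The coordinates are minimized successively, each among the members of `F` that agree with the
earlier minima. Every prefix of `a` is attained in `F`, but `a` itself need only lie in the closure
of `F`. -/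
theorem exists_lexicographic_min {F : Set (ℕ → ℕ)} (hF : F.Nonempty) :
    ∃ a : ℕ → ℕ, ∀ n, (∃ b ∈ F, ∀ i < n + 1, b i = a i) ∧
      ∀ m < a n, ¬ ∃ b ∈ F, (∀ i < n, b i = a i) ∧ b n = m := by
  let P : ℕ → Set (ℕ → ℕ) := fun n =>
    Nat.rec F (fun n P => {b ∈ P | b n = sInf ((fun b => b n) '' P)}) n
  let a : ℕ → ℕ := fun n => sInf ((fun b : ℕ → ℕ => b n) '' P n)
  have hP : ∀ n, P (n + 1) = {b ∈ P n | b n = a n} := fun n => rfl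
  have hne : ∀ n, (P n).Nonempty := by
    intro n
    induction n with
    | zero => exact hF
    | succ n ih =>
      obtain ⟨b, hb, hbn⟩ := Nat.sInf_mem (ih.image fun b : ℕ → ℕ => b n)
      exact ⟨b, hb, hbn⟩
  have hchar : ∀ n, P n = {b ∈ F | ∀ i < n, b i = a i} := by
    intro n
    induction n with
    | zero => simp [P]
    | succ n ih =>
      rw [hP, ih]
      ext b
      simp only [mem_ofPred_eq, Nat.lt_succ_iff_lt_or_eq]
      constructor
      · rintro ⟨⟨h1, h2⟩, h3⟩
        refine ⟨h1, ?_⟩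
        rintro i (hi | rfl)
        · exact h2 i hi
        · exact h3
      · rintro ⟨h1, h2⟩
        exact ⟨⟨h1, fun i hi => h2 i (Or.inl hi)⟩, h2 n (Or.inr rfl)⟩
  refine ⟨a, fun n => ⟨?_, ?_⟩⟩
  · obtain ⟨b, hb⟩ := hne (n + 1)
    exact ⟨b, (hchar (n + 1)).subset hb⟩
  · rintro m hm ⟨b, hb, hbi, rfl⟩
    refine Nat.notMem_of_lt_sInf hm ⟨b, ?_, rfl⟩
    rw [hchar]
    exact ⟨hb, hbi⟩

/-- Measurable choice of a lexicographically minimal sequence in the closure of a set of sequences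
depending measurably on a parameter. -/
theorem exists_measurable_mem_closure_baire {Ω : Type*} [MeasurableSpace Ω]
    (F : Ω → Set (ℕ → ℕ))
    (hF : ∀ (n : ℕ) (l : ℕ → ℕ), MeasurableSet {x | ∃ b ∈ F x, ∀ i < n, b i = l i}) :
    ∃ a : Ω → ℕ → ℕ, Measurable a ∧ (∀ x, (F x).Nonempty → a x ∈ closure (F x)) ∧
      ∀ x y, F x = F y → a x = a y := by
  classical
  let A : Set (ℕ → ℕ) → ℕ → ℕ := fun F =>
    if h : F.Nonempty then (exists_lexicographic_min h).choose else 0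
  have hA : ∀ F : Set (ℕ → ℕ), F.Nonempty → ∀ n, (∃ b ∈ F, ∀ i < n + 1, b i = A F i) ∧
      ∀ m < A F n, ¬ ∃ b ∈ F, (∀ i < n, b i = A F i) ∧ b n = m := by
    intro F h
    simp only [A, h, dif_pos]
    exact (exists_lexicographic_min h).choose_spec
  have hA0 : ∀ F : Set (ℕ → ℕ), ¬ F.Nonempty → A F = 0 := fun F h => dif_neg h
  have hne : MeasurableSet {x | (F x).Nonempty} := by
    simpa [Set.Nonempty] using hF 0 0
  have hmeas : ∀ (n : ℕ) (l : ℕ → ℕ), MeasurableSet {x | ∀ i < n, A (F x) i = l i} := by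
    intro n l
    have : {x | ∀ i < n, A (F x) i = l i} =
        ({x | (F x).Nonempty} ∩ {x | (F x).Nonempty ∧ ∀ i < n, A (F x) i = l i}) ∪
          ({x | (F x).Nonempty}ᶜ ∩ {x | ∀ i < n, (0 : ℕ) = l i}) := by
      ext x
      by_cases h : (F x).Nonempty
      · simp [h]
      · simp [h, hA0 _ h]
    rw [this]
    refine (hne.inter ?_).union (hne.compl.inter (MeasurableSet.const _))
    clear this
    induction n with
    | zero => simpa using hne
    | succ n ih =>
      -- Once the minimum agrees with `l` before `n`, its next entry is `l n` exactly when `F x`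
      -- meets the cylinder of `l` and no cylinder with a smaller entry at `n`. These are hitting
      -- conditions on cylinders.
      have key : {x | (F x).Nonempty ∧ ∀ i < n + 1, A (F x) i = l i} =
          {x | (F x).Nonempty ∧ ∀ i < n, A (F x) i = l i} ∩
            {x | ∃ b ∈ F x, ∀ i < n + 1, b i = l i} ∩
            ⋂ m : ℕ, ⋂ _ : m < l n,
              {x | ∃ b ∈ F x, ∀ i < n + 1, b i = Function.update l n m i}ᶜ := by
        ext x
        have upd : ∀ (b : ℕ → ℕ) (m : ℕ), (∀ i < n + 1, b i = Function.update l n m i) ↔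
            (∀ i < n, b i = l i) ∧ b n = m := by
          intro b m
          constructor
          · intro h
            refine ⟨fun i hi => ?_, ?_⟩
            · rw [h i (by omega), Function.update_of_ne (by omega)]
            · rw [h n (by omega), Function.update_self]
          · rintro ⟨h1, h2⟩ i hi
            rcases Nat.lt_succ_iff_lt_or_eq.1 hi with h | rfl
            · rw [h1 i h, Function.update_of_ne (by omega)]
            · rw [h2, Function.update_self]
        simp only [mem_inter_iff, mem_iInter, mem_compl_iff, mem_ofPred_eq, upd]
        constructor
        · rintro ⟨h0, h1⟩
          obtain ⟨⟨b, hb, hbi⟩, h3⟩ := hA _ h0 n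
          refine ⟨⟨⟨h0, fun i hi => h1 i (by omega)⟩, b, hb, fun i hi => ?_⟩, ?_⟩
          · rw [hbi i hi, h1 i hi]
          · intro m hm hex
            rw [← h1 n (by omega)] at hm
            refine h3 m hm ?_
            obtain ⟨b, hb, hbi, hbn⟩ := hex
            exact ⟨b, hb, fun i hi => (hbi i hi).trans (h1 i (by omega)).symm, hbn⟩
        · rintro ⟨⟨⟨h0, h1⟩, b, hb, hbi⟩, h3⟩
          refine ⟨h0, fun i hi => ?_⟩
          rcases Nat.lt_succ_iff_lt_or_eq.1 hi with h | rfl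
          · exact h1 i h
          obtain ⟨⟨b', hb', hbi'⟩, h3'⟩ := hA _ h0 i
          rcases lt_trichotomy (A (F x) i) (l i) with h | h | h
          · refine absurd ⟨b', hb', fun j hj => ?_, hbi' i (by omega)⟩ (h3 _ h)
            rw [hbi' j (by omega), h1 j hj]
          · exact h
          · refine absurd ⟨b, hb, fun j hj => ?_, hbi i (by omega)⟩ (h3' _ h)
            rw [hbi j (by omega), h1 j hj]
      rw [key]
      exact (ih.inter (hF _ _)).inter
        (MeasurableSet.iInter fun m => MeasurableSet.iInter fun _ => (hF _ _).compl)
  refine ⟨fun x => A (F x), ?_, fun x hx => ?_, fun x y h => by simp [h]⟩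
  · rw [measurable_pi_iff]
    intro n
    have h1 : Measurable fun x => fun i : Fin (n + 1) => A (F x) i := by
      refine measurable_to_countable' fun l => ?_
      convert hmeas (n + 1) (fun i => if h : i < n + 1 then l ⟨i, h⟩ else 0) using 1
      ext x
      simp only [mem_preimage, mem_singleton_iff, mem_ofPred_eq, funext_iff]
      constructor
      · intro h i hi
        rw [dif_pos hi, ← h ⟨i, hi⟩]
      · intro h i
        rw [h i i.2, dif_pos i.2]
    exact (measurable_pi_apply (Fin.last n)).comp h1
  · choose b hb hbi using fun n => (hA _ hx n).1
    refine mem_closure_of_tendsto (f := b) (b := Filter.atTop) ?_ (Filter.Eventually.of_forall hb)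
    rw [tendsto_pi_nhds]
    intro i
    refine tendsto_const_nhds.congr' ?_
    filter_upwards [Filter.eventually_ge_atTop i] with n hn
    exact (hbi n i (by omega)).symm

/-- A parametrized family of sets, whose hitting sets of analytic sets are measurable, admits a
measurable selection of a point of the closure that only depends on the set. -/
theorem exists_measurable_mem_closure {Ω X : Type*} [MeasurableSpace Ω] [TopologicalSpace X]
    [PolishSpace X] [Nonempty X] [MeasurableSpace X] [BorelSpace X] (C : Ω → Set X)
    (hC : ∀ A : Set X, AnalyticSet A → MeasurableSet {x | (C x ∩ A).Nonempty}) :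
    ∃ f : Ω → X, Measurable f ∧ (∀ x, (C x).Nonempty → f x ∈ closure (C x)) ∧
      ∀ x y, C x = C y → f x = f y := by
  -- The selection is made in Baire space and pushed down by `h`; images of cylinders are analytic,
  -- so the hypothesis covers their hitting sets.
  obtain ⟨h, hcont, hsurj⟩ := _root_.PolishSpace.exists_nat_nat_continuous_surjective X
  obtain ⟨a, ha, hcl, heq⟩ := exists_measurable_mem_closure_baire (fun x => h ⁻¹' C x) (by
    intro n l
    have hopen : IsOpen {b : ℕ → ℕ | ∀ i < n, b i = l i} := PiNat.isOpen_cylinder _ l n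
    convert hC _ (hopen.analyticSet_image hcont) using 1
    ext x
    constructor
    · rintro ⟨b, hb, hbi⟩
      exact ⟨h b, hb, b, hbi, rfl⟩
    · rintro ⟨_, hx, b, hbi, rfl⟩
      exact ⟨b, hx, hbi⟩)
  refine ⟨fun x => h (a x), hcont.measurable.comp ha, fun x hx => ?_, fun x y hxy => ?_⟩
  · exact hcont.closure_preimage_subset _ (hcl x (hx.preimage hsurj))
  · simp only
    rw [heq x y (by simp [hxy])]

end Selection

/-! ### Order and geometry of non-branching rays. -/

section RayOrder

/-- A relation made of the oriented pairs of points on a family of `d_L`-rays: it is transitive,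
`d_L` is finite on it and additive along it, and it contains the pairs of points in between. -/
structure IsRayOrder {X : Type*} (dL : X → X → ℝ≥0∞) (G : Set (X × X)) : Prop where
  ne_top : ∀ {x y}, (x, y) ∈ G → dL x y ≠ ∞
  trans : ∀ {x y z}, (x, y) ∈ G → (y, z) ∈ G → (x, z) ∈ G
  add : ∀ {x y z}, (x, y) ∈ G → (y, z) ∈ G → dL x z = dL x y + dL y z
  between : ∀ {x y z}, (x, z) ∈ G → dL x y + dL y z = dL x z → (x, y) ∈ G ∧ (y, z) ∈ G

/-- Points with a strict predecessor and a strict successor. -/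
def rayInterior {X : Type*} (G : Set (X × X)) : Set X :=
  {x | (∃ y, (y, x) ∈ G ∧ y ≠ x) ∧ ∃ y, (x, y) ∈ G ∧ y ≠ x}

variable {X : Type*} {dL : X → X → ℝ≥0∞} {G : Set (X × X)}

theorem IsRayOrder.swap (hG : IsRayOrder dL G) (hsymm : ∀ x y, dL x y = dL y x) :
    IsRayOrder dL (Prod.swap ⁻¹' G) where
  ne_top h := by rw [hsymm]; exact hG.ne_top h
  trans h h' := hG.trans h' h
  add {x y z} h h' := by
    rw [hsymm x z, hsymm x y, hsymm y z, add_comm]; exact hG.add h' h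
  between {x y z} h h' := by
    rw [hsymm x z, hsymm x y, hsymm y z, add_comm] at h'
    exact (hG.between h h').symm

variable [MetricSpace X] [MeasurableSpace X]

theorem GeodesicStructure.self (hdL : GeodesicStructure dL) (x : X) : dL x x = 0 :=
  (hdL.eq_zero_iff x x).2 rfl

theorem GeodesicStructure.exists_between (hdL : GeodesicStructure dL) {x y : X} {a b : ℝ≥0}
    (h : dL x y = a + b) : ∃ z, dL x z = a ∧ dL z y = b := by
  have hfin : dL x y < ∞ := by rw [h]; exact ENNReal.add_lt_top.2 ⟨by simp, by simp⟩
  obtain ⟨γ, ⟨-, hγ⟩, h0, h1⟩ := hdL.geodesic x y hfin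
  have hL : (dL x y).toReal = a + b := by
    rw [h, ENNReal.toReal_add (by simp) (by simp)]; simp
  rw [hL] at hγ h1
  have ha := a.2
  have hb := b.2
  refine ⟨γ a, ?_, ?_⟩
  · rw [← h0, hγ 0 ⟨le_rfl, by positivity⟩ a ⟨ha, by simp⟩]
    simp
  · nth_rewrite 1 [← h1]
    rw [hγ a ⟨ha, by simp⟩ _ ⟨by positivity, le_rfl⟩]
    simp

namespace IsRayOrder

theorem exists_between (hG : IsRayOrder dL G) (hdL : GeodesicStructure dL) {x y : X} {a b : ℝ≥0}
    (hxy : (x, y) ∈ G) (h : dL x y = a + b) :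
    ∃ z, (x, z) ∈ G ∧ (z, y) ∈ G ∧ dL x z = a ∧ dL z y = b := by
  obtain ⟨z, h1, h2⟩ := hdL.exists_between h
  obtain ⟨h3, h4⟩ := hG.between hxy (y := z) (by rw [h1, h2, h])
  exact ⟨z, h3, h4, h1, h2⟩

theorem refl_right (hG : IsRayOrder dL G) (hdL : GeodesicStructure dL) {x y : X}
    (h : (x, y) ∈ G) : (y, y) ∈ G :=
  (hG.between h (y := y) (by rw [hdL.self, add_zero])).2

theorem antisymm (hG : IsRayOrder dL G) (hdL : GeodesicStructure dL) {x y : X}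
    (h : (x, y) ∈ G) (h' : (y, x) ∈ G) : x = y := by
  have := hG.add h h'
  rw [hdL.self] at this
  exact (hdL.eq_zero_iff x y).1 (add_eq_zero.1 this.symm).1

/-- Rays do not branch forward at a point with a strict predecessor. -/
theorem eq_of_common_source (hG : IsRayOrder dL G) (hdL : GeodesicStructure dL) {a : ℝ≥0} (n : ℕ) :
    ∀ {p y x z : X} {L : ℝ≥0}, (p, y) ∈ G → dL p y = a → (y, x) ∈ G → (y, z) ∈ G → dL y x = L →
      dL y z = L → L ≤ n * a → x = z := by
  have base : ∀ {p y x z : X} {L : ℝ≥0}, (p, y) ∈ G → dL p y = a → (y, x) ∈ G → (y, z) ∈ G →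
      dL y x = L → dL y z = L → L ≤ a → x = z := by
    intro p y x z L hpy ha hyx hyz hx hz hL
    -- Backing up from `y` by exactly `L ≤ a` makes `y` the midpoint of both `q → x` and `q → z`,
    -- the configuration to which non-branching applies.
    obtain ⟨q, -, hqy, -, hq⟩ := hG.exists_between hdL (a := a - L) (b := L) hpy
      (by rw [ha, ← ENNReal.coe_add, tsub_add_cancel_of_le hL])
    have hhalf : ((2 * L : ℝ≥0) : ℝ≥0∞) / 2 = L := by
      rw [ENNReal.coe_mul, mul_comm]
      exact ENNReal.mul_div_cancel_right (by simp) (by simp)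
    have hsum : ∀ w, (y, w) ∈ G → dL y w = L → dL q w = (2 * L : ℝ≥0) := by
      intro w hw hL'
      rw [hG.add hqy hw, hq, hL', ← ENNReal.coe_add, two_mul]
    refine hdL.nonBranching (2 * L) q y (by rw [hhalf, hq]) ⟨hsum x hyx hx, ?_⟩ ⟨hsum z hyz hz, ?_⟩
    · exact hx.trans hhalf.symm
    · exact hz.trans hhalf.symm
  induction n with
  | zero =>
    intro p y x z L hpy ha hyx hyz hx hz hL
    exact base hpy ha hyx hyz hx hz (hL.trans (by simp))
  | succ n ih =>
    intro p y x z L hpy ha hyx hyz hx hz hL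
    rcases le_total L a with h | h
    · exact base hpy ha hyx hyz hx hz h
    -- For `L > a`, both rays advance by `a`. The base case identifies the two new points, and `y`
    -- becomes the predecessor, again at distance `a`.
    obtain ⟨x', hx1, hx2, hx3, hx4⟩ := hG.exists_between hdL (a := a) (b := L - a) hyx
      (by rw [hx, ← ENNReal.coe_add, add_tsub_cancel_of_le h])
    obtain ⟨z', hz1, hz2, hz3, hz4⟩ := hG.exists_between hdL (a := a) (b := L - a) hyz
      (by rw [hz, ← ENNReal.coe_add, add_tsub_cancel_of_le h])
    obtain rfl := base hpy ha hx1 hz1 hx3 hz3 le_rfl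
    refine ih hx1 hx3 hx2 hz2 hx4 hz4 ?_
    rw [tsub_le_iff_right]
    refine hL.trans_eq ?_
    push_cast
    ring

/-- The point between `y` and `x'` at the same distance from `y` as `x` must be `x`, since rays do
not branch at `y`. -/
theorem mem_of_common_source (hG : IsRayOrder dL G) (hdL : GeodesicStructure dL) {p y x x' : X}
    (hpy : (p, y) ∈ G) (hne : p ≠ y) (hx : (y, x) ∈ G) (hx' : (y, x') ∈ G)
    (hle : dL y x ≤ dL y x') : (x, x') ∈ G := by
  obtain ⟨a, ha⟩ : ∃ c : ℝ≥0, (c : ℝ≥0∞) = dL p y := ⟨_, ENNReal.coe_toNNReal (hG.ne_top hpy)⟩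
  obtain ⟨L, hL⟩ : ∃ c : ℝ≥0, (c : ℝ≥0∞) = dL y x := ⟨_, ENNReal.coe_toNNReal (hG.ne_top hx)⟩
  obtain ⟨L', hL'⟩ : ∃ c : ℝ≥0, (c : ℝ≥0∞) = dL y x' := ⟨_, ENNReal.coe_toNNReal (hG.ne_top hx')⟩
  rw [← hL, ← hL', ENNReal.coe_le_coe] at hle
  obtain ⟨z, hz1, hz2, hz3, -⟩ := hG.exists_between hdL (a := L) (b := L' - L) hx'
    (by rw [← hL', ← ENNReal.coe_add, add_tsub_cancel_of_le hle])
  have ha0 : 0 < a := by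
    rw [pos_iff_ne_zero]
    rintro rfl
    exact hne ((hdL.eq_zero_iff p y).1 ha.symm)
  obtain ⟨n, hn⟩ := exists_nat_ge (L / a)
  rw [div_le_iff₀ ha0] at hn
  rwa [hG.eq_of_common_source hdL n hpy ha.symm hx hz1 hL.symm hz3 hn]

theorem mem_of_common_target (hG : IsRayOrder dL G) (hdL : GeodesicStructure dL) {p y x x' : X}
    (hpy : (y, p) ∈ G) (hne : p ≠ y) (hx : (x, y) ∈ G) (hx' : (x', y) ∈ G)
    (hle : dL x y ≤ dL x' y) : (x', x) ∈ G := by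
  rw [hdL.symm x, hdL.symm x'] at hle
  exact (hG.swap hdL.symm).mem_of_common_source hdL (p := p) (y := y) hpy hne hx hx' hle

theorem comparable_of_common_source (hG : IsRayOrder dL G) (hdL : GeodesicStructure dL)
    {p y x x' : X} (hpy : (p, y) ∈ G) (hne : p ≠ y) (hx : (y, x) ∈ G) (hx' : (y, x') ∈ G) :
    (x, x') ∈ G ∨ (x', x) ∈ G :=
  (le_total (dL y x) (dL y x')).imp (hG.mem_of_common_source hdL hpy hne hx hx')
    (hG.mem_of_common_source hdL hpy hne hx' hx)

theorem comparable_of_common_target (hG : IsRayOrder dL G) (hdL : GeodesicStructure dL)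
    {p y x x' : X} (hpy : (y, p) ∈ G) (hne : p ≠ y) (hx : (x, y) ∈ G) (hx' : (x', y) ∈ G) :
    (x, x') ∈ G ∨ (x', x) ∈ G :=
  (le_total (dL x y) (dL x' y)).symm.imp (hG.mem_of_common_target hdL hpy hne hx' hx)
    (hG.mem_of_common_target hdL hpy hne hx hx')

/-- Two points on the same ray as an interior point are on the same ray. -/
theorem comparable (hG : IsRayOrder dL G) (hdL : GeodesicStructure dL) {x y z : X}
    (hy : y ∈ rayInterior G) (hxy : (x, y) ∈ G ∨ (y, x) ∈ G) (hyz : (y, z) ∈ G ∨ (z, y) ∈ G) :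
    (x, z) ∈ G ∨ (z, x) ∈ G := by
  obtain ⟨⟨p, hp, hpne⟩, q, hq, hqne⟩ := hy
  rcases hxy with hxy | hxy <;> rcases hyz with hyz | hyz
  · exact Or.inl (hG.trans hxy hyz)
  · exact hG.comparable_of_common_target hdL hq hqne hxy hyz
  · exact hG.comparable_of_common_source hdL hp hpne hxy hyz
  · exact Or.inr (hG.trans hyz hxy)

/-- The ray through `x`, without its end points. -/
def _root_.openRay (G : Set (X × X)) (x : X) : Set X :=
  {z | z ∈ rayInterior G ∧ ((x, z) ∈ G ∨ (z, x) ∈ G)}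

theorem openRay_eq (hG : IsRayOrder dL G) (hdL : GeodesicStructure dL) {x y : X}
    (hx : x ∈ rayInterior G) (hy : y ∈ rayInterior G) (hxy : (x, y) ∈ G ∨ (y, x) ∈ G) :
    openRay G x = openRay G y := by
  ext z
  exact and_congr_right fun hz =>
    ⟨fun h => hG.comparable hdL hx hxy.symm h, fun h => hG.comparable hdL hy hxy h⟩

open Classical in
/-- The signed `d_L`-distance from `x` along the ray through `x`. -/
noncomputable def _root_.rayCoord (dL : X → X → ℝ≥0∞) (G : Set (X × X)) (x z : X) : ℝ :=
  if (x, z) ∈ G then (dL x z).toReal else -(dL z x).toReal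

theorem rayCoord_of_mem (hG : IsRayOrder dL G) (hdL : GeodesicStructure dL) {x z : X}
    (h : (z, x) ∈ G) : rayCoord dL G x z = -(dL z x).toReal := by
  rw [rayCoord]
  split_ifs with h'
  · obtain rfl := hG.antisymm hdL h h'
    simp [hdL.self]
  · rfl

omit [MetricSpace X] [MeasurableSpace X] in
theorem toReal_add (hG : IsRayOrder dL G) {x y z : X} (h : (x, y) ∈ G) (h' : (y, z) ∈ G) :
    (dL x z).toReal = (dL x y).toReal + (dL y z).toReal := by
  rw [hG.add h h', ENNReal.toReal_add (hG.ne_top h) (hG.ne_top h')]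

theorem rayCoord_sub (hG : IsRayOrder dL G) (hdL : GeodesicStructure dL) {x z z' : X}
    (hz : z ∈ openRay G x) (hz' : z' ∈ openRay G x) (h : (z, z') ∈ G) :
    rayCoord dL G x z' - rayCoord dL G x z = (dL z z').toReal := by
  have pos : ∀ {w}, (x, w) ∈ G → rayCoord dL G x w = (dL x w).toReal := fun hw => if_pos hw
  rcases hz.2 with h1 | h1
  · rw [pos h1, pos (hG.trans h1 h), hG.toReal_add h1 h]
    ring
  · rcases hz'.2 with h2 | h2
    · rw [hG.rayCoord_of_mem hdL h1, pos h2, hG.toReal_add h1 h2]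
      ring
    · rw [hG.rayCoord_of_mem hdL h1, hG.rayCoord_of_mem hdL h2, hG.toReal_add h h2]
      ring

theorem abs_rayCoord_sub (hG : IsRayOrder dL G) (hdL : GeodesicStructure dL) {x z z' : X}
    (hx : x ∈ rayInterior G) (hz : z ∈ openRay G x) (hz' : z' ∈ openRay G x) :
    |rayCoord dL G x z - rayCoord dL G x z'| = (dL z z').toReal := by
  rcases hG.comparable hdL hx hz.2.symm hz'.2 with h | h
  · rw [abs_sub_comm, hG.rayCoord_sub hdL hz hz' h, abs_of_nonneg ENNReal.toReal_nonneg]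
  · rw [hG.rayCoord_sub hdL hz' hz h, abs_of_nonneg ENNReal.toReal_nonneg, hdL.symm]

theorem dL_eq_ofReal (hG : IsRayOrder dL G) (hdL : GeodesicStructure dL) {x z z' : X}
    (hx : x ∈ rayInterior G) (hz : z ∈ openRay G x) (hz' : z' ∈ openRay G x) :
    dL z z' = ENNReal.ofReal |rayCoord dL G x z - rayCoord dL G x z'| := by
  rw [hG.abs_rayCoord_sub hdL hx hz hz', ENNReal.ofReal_toReal]
  rcases hG.comparable hdL hx hz.2.symm hz'.2 with h | h
  · exact hG.ne_top h
  · rw [hdL.symm]; exact hG.ne_top h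

theorem injOn_rayCoord (hG : IsRayOrder dL G) (hdL : GeodesicStructure dL) {x : X}
    (hx : x ∈ rayInterior G) : InjOn (rayCoord dL G x) (openRay G x) := by
  intro z hz z' hz' h
  rw [← hdL.eq_zero_iff, hG.dL_eq_ofReal hdL hx hz hz', h]
  simp

/-- A geodesic joining two points of the open ray stays on it, since intermediate points have strict
neighbours on both sides. The coordinates thus form an interval, as `IsGeodesicOn` demands. -/
theorem ordConnected_image_rayCoord (hG : IsRayOrder dL G) (hdL : GeodesicStructure dL) {x : X}
    (hx : x ∈ rayInterior G) : (rayCoord dL G x '' openRay G x).OrdConnected := by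
  refine ⟨?_⟩
  rintro _ ⟨z, hz, rfl⟩ _ ⟨z', hz', rfl⟩ s ⟨hs, hs'⟩
  rcases hs.eq_or_lt with rfl | hs
  · exact mem_image_of_mem _ hz
  rcases hs'.eq_or_lt with rfl | hs'
  · exact mem_image_of_mem _ hz'
  have hzz' : (z, z') ∈ G := by
    rcases hG.comparable hdL hx hz.2.symm hz'.2 with h | h
    · exact h
    · have h1 := hG.rayCoord_sub hdL hz' hz h
      have h2 : 0 ≤ (dL z' z).toReal := ENNReal.toReal_nonneg
      linarith
  have hsub := hG.rayCoord_sub hdL hz hz' hzz'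
  obtain ⟨w, hw1, hw2, ha, hb⟩ := hG.exists_between hdL hzz'
    (a := (s - rayCoord dL G x z).toNNReal) (b := (rayCoord dL G x z' - s).toNNReal) (by
      change _ = ENNReal.ofReal _ + ENNReal.ofReal _
      rw [← ENNReal.ofReal_add (by linarith) (by linarith),
        ← ENNReal.ofReal_toReal (hG.ne_top hzz'), ← hsub]
      congr 1
      ring)
  have hw : w ∈ rayInterior G := by
    refine ⟨⟨z, hw1, ?_⟩, z', hw2, ?_⟩
    · rintro rfl
      rw [hdL.self] at ha
      have : ENNReal.ofReal (s - rayCoord dL G x z) = 0 := ha.symm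
      rw [ENNReal.ofReal_eq_zero] at this
      linarith
    · rintro rfl
      rw [hdL.self] at hb
      have : ENNReal.ofReal (rayCoord dL G x z' - s) = 0 := hb.symm
      rw [ENNReal.ofReal_eq_zero] at this
      linarith
  have hwC : w ∈ openRay G x := ⟨hw, hG.comparable hdL hz.1 hz.2 (Or.inl hw1)⟩
  refine ⟨w, hwC, ?_⟩
  have hsw := hG.rayCoord_sub hdL hz hwC hw1
  rw [ha, ENNReal.coe_toReal, Real.coe_toNNReal _ (by linarith)] at hsw
  linarith

/-- Every interior point of a ray has arbitrarily small closed balls whose intersection with the ray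
is `d`-compact. -/
theorem exists_isCompact_openRay_inter_closedBall (hG : IsRayOrder dL G)
    (hdL : GeodesicStructure dL) {x : X} (hx : x ∈ rayInterior G) :
    ∃ r > 0, IsCompact (openRay G x ∩ Metric.closedBall x r) := by
  have : Nonempty X := ⟨x⟩
  set τ := rayCoord dL G x
  set C := openRay G x
  -- The inverse of the signed coordinate is a geodesic covering the whole open ray, so the
  -- regularity assumptions on geodesics apply to the ray itself.
  set γ := Function.invFunOn τ C
  have hinj : InjOn τ C := hG.injOn_rayCoord hdL hx
  have hleft : ∀ z ∈ C, γ (τ z) = z := fun z hz => hinj.leftInvOn_invFunOn hz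
  have hgeo : IsGeodesicOn dL (τ '' C) γ := by
    refine ⟨hG.ordConnected_image_rayCoord hdL hx, ?_⟩
    rintro _ ⟨z, hz, rfl⟩ _ ⟨z', hz', rfl⟩
    rw [hleft z hz, hleft z' hz']
    exact hG.dL_eq_ofReal hdL hx hz hz'
  have hxC : x ∈ C := by
    obtain ⟨⟨p, hp, -⟩, -⟩ := id hx
    exact ⟨hx, Or.inl (hG.refl_right hdL hp)⟩
  obtain ⟨r, hr, hc⟩ := hdL.locallyCompact _ γ hgeo (τ x) (mem_image_of_mem τ hxC)
  rw [hleft x hxC] at hc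
  refine ⟨r, hr, ?_⟩
  have himage : γ '' (τ '' C ∩ γ ⁻¹' Metric.closedBall x r) = C ∩ Metric.closedBall x r := by
    ext z
    constructor
    · rintro ⟨_, ⟨⟨z', hz', rfl⟩, hb⟩, rfl⟩
      rw [mem_preimage, hleft z' hz'] at hb
      rw [hleft z' hz']
      exact ⟨hz', hb⟩
    · rintro ⟨hz, hb⟩
      exact ⟨τ z, ⟨mem_image_of_mem τ hz, by rwa [mem_preimage, hleft z hz]⟩, hleft z hz⟩
  rw [← himage]
  exact hc.image_of_continuousOn ((hdL.continuous _ γ hgeo).mono inter_subset_left)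

end IsRayOrder

end RayOrder

/-! ### Splicing cycles of zero cost. -/

section ZeroCycles

variable {X : Type*} {dL : X → X → ℝ≥0∞} {Γ : Set (X × X)}

/-- A cyclic sum is the sum over the chain plus the closing term. -/
theorem Fin.sum_cyclic_shift {M : Type*} [AddCommMonoid M] (c : X → X → M) {n : ℕ}
    (w z : Fin (n + 1) → X) :
    ∑ i, c (w (i + 1)) (z i) =
      ∑ i : Fin n, c (w i.succ) (z i.castSucc) + c (w 0) (z (Fin.last n)) := by
  simp [Fin.sum_univ_castSucc]

theorem sum_chain_append {M : Type*} [AddCommMonoid M] (c : X → X → M) {n m : ℕ}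
    (w z : Fin (n + 1) → X) (w' z' : Fin (m + 1) → X) :
    ∑ i : Fin (n + 1 + m), c (Fin.append w w' i.succ) (Fin.append z z' i.castSucc) =
      ∑ i : Fin n, c (w i.succ) (z i.castSucc) + c (w' 0) (z (Fin.last n)) +
        ∑ i : Fin m, c (w' i.succ) (z' i.castSucc) := by
  rw [Fin.sum_univ_add, Fin.sum_univ_castSucc]
  congr 1
  · congr 1
    · refine Finset.sum_congr rfl fun i _ => ?_
      congr 1
      · exact Fin.append_left w w' i.succ
      · exact Fin.append_left z z' i.castSucc
    · congr 1
      · exact Fin.append_right w w' 0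
      · exact Fin.append_left z z' (Fin.last n)
  · refine Finset.sum_congr rfl fun i _ => ?_
    congr 1
    · exact Fin.append_right w w' i.succ
    · exact Fin.append_right z z' i.castSucc

theorem sum_ne_top_of_mem (hfin : ∀ p ∈ Γ, dL p.1 p.2 < ∞) {n : ℕ} {w z : Fin (n + 1) → X}
    (h : ∀ i, (w i, z i) ∈ Γ) : ∑ i, dL (w i) (z i) ≠ ∞ :=
  ENNReal.sum_ne_top.2 fun i _ => (hfin _ (h i)).ne

theorem ne_top_of_mem_zeroCycles (hfin : ∀ p ∈ Γ, dL p.1 p.2 < ∞) {x y : X}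
    (h : (x, y) ∈ zeroCycles dL Γ) : dL x y ≠ ∞ := by
  obtain ⟨n, w, z, hΓ, rfl, rfl, hsum⟩ := h
  have := sum_ne_top_of_mem hfin hΓ
  rw [← hsum, Fin.sum_cyclic_shift] at this
  exact (ENNReal.add_ne_top.1 this).2

/-- Two cycles of zero cost can be joined into a longer one, if this does not increase the cost. -/
theorem zeroCycles_splice (hmono : CyclicallyMonotone dL Γ) (hfin : ∀ p ∈ Γ, dL p.1 p.2 < ∞)
    {x y x' y' : X} (h : (x, y) ∈ zeroCycles dL Γ) (h' : (x', y') ∈ zeroCycles dL Γ)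
    (hle : dL x' y + dL x y' ≤ dL x y + dL x' y') :
    (x, y') ∈ zeroCycles dL Γ ∧ dL x' y + dL x y' = dL x y + dL x' y' := by
  obtain ⟨n, w, z, hΓ, rfl, rfl, hsum⟩ := h
  obtain ⟨m, w', z', hΓ', rfl, rfl, hsum'⟩ := h'
  have hmem : ∀ i : Fin (n + 1 + m + 1), ((Fin.append w w' : Fin (n + 1 + (m + 1)) → X) i,
      (Fin.append z z' : Fin (n + 1 + (m + 1)) → X) i) ∈ Γ := by
    intro i
    refine Fin.addCases (m := n + 1) (n := m + 1) (fun j => ?_) (fun j => ?_) i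
    · rw [Fin.append_left, Fin.append_left]; exact hΓ j
    · rw [Fin.append_right, Fin.append_right]; exact hΓ' j
  have hfirst : (Fin.append w w' : Fin (n + 1 + (m + 1)) → X) (0 : Fin (n + 1 + m + 1)) = w 0 :=
    Fin.append_left w w' 0
  have hlast : (Fin.append z z' : Fin (n + 1 + (m + 1)) → X) (Fin.last (n + 1 + m)) =
      z' (Fin.last m) := Fin.append_right z z' (Fin.last m)
  have hcm := hmono (n + 1 + m) _ _ hmem
  have htop := sum_ne_top_of_mem hfin hΓ
  have htop' := sum_ne_top_of_mem hfin hΓ'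
  have hcost : ∑ i : Fin (n + 1 + m + 1), dL ((Fin.append w w' : Fin (n + 1 + (m + 1)) → X) i)
      ((Fin.append z z' : Fin (n + 1 + (m + 1)) → X) i) =
      ∑ i, dL (w i) (z i) + ∑ i, dL (w' i) (z' i) := by
    rw [show (∑ i : Fin (n + 1 + m + 1), dL ((Fin.append w w' : Fin (n + 1 + (m + 1)) → X) i)
      ((Fin.append z z' : Fin (n + 1 + (m + 1)) → X) i)) = _ from
        Fin.sum_univ_add (a := n + 1) (b := m + 1) _]
    simp
  have hshift := Fin.sum_cyclic_shift dL (n := n + 1 + m)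
    (Fin.append w w' : Fin (n + 1 + (m + 1)) → X) (Fin.append z z' : Fin (n + 1 + (m + 1)) → X)
  rw [sum_chain_append, hfirst, hlast] at hshift
  rw [Fin.sum_cyclic_shift] at hsum hsum'
  set O := ∑ i : Fin n, dL (w i.succ) (z i.castSucc)
  set O' := ∑ i : Fin m, dL (w' i.succ) (z' i.castSucc)
  have hO : O + O' ≠ ∞ := by
    rw [← hsum] at htop
    rw [← hsum'] at htop'
    exact ENNReal.add_ne_top.2 ⟨(ENNReal.add_ne_top.1 htop).1, (ENNReal.add_ne_top.1 htop').1⟩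
  have e1 : O + dL (w' 0) (z (Fin.last n)) + O' + dL (w 0) (z' (Fin.last m)) =
      (O + O') + (dL (w' 0) (z (Fin.last n)) + dL (w 0) (z' (Fin.last m))) := by ring
  have e2 : ∑ i, dL (w i) (z i) + ∑ i, dL (w' i) (z' i) =
      (O + O') + (dL (w 0) (z (Fin.last n)) + dL (w' 0) (z' (Fin.last m))) := by
    rw [← hsum, ← hsum']; ring
  rw [e1] at hshift
  rw [e2] at hcost
  -- Cyclical monotonicity of the concatenated cycle gives the inequality opposite to `hle`, after
  -- cancelling the finite common part.
  have heq : dL (w' 0) (z (Fin.last n)) + dL (w 0) (z' (Fin.last m)) =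
      dL (w 0) (z (Fin.last n)) + dL (w' 0) (z' (Fin.last m)) := by
    refine le_antisymm hle ?_
    rw [hshift, hcost] at hcm
    exact (ENNReal.add_le_add_iff_left hO).1 hcm
  exact ⟨⟨n + 1 + m, _, _, hmem, hfirst, hlast, by rw [hshift, hcost, heq]⟩, heq⟩

end ZeroCycles

/-! ### The transport rays form a ray order. -/

section OrientedRays

variable {X : Type*} [MetricSpace X] [MeasurableSpace X] {dL : X → X → ℝ≥0∞} {Γ : Set (X × X)}

theorem isRayOrder_orientedRays (hdL : GeodesicStructure dL) (hmono : CyclicallyMonotone dL Γ)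
    (hfin : ∀ p ∈ Γ, dL p.1 p.2 < ∞) : IsRayOrder dL (orientedRays dL Γ) := by
  have hlift : ∀ {w x y z : X}, (w, z) ∈ zeroCycles dL Γ →
      dL w x + dL x y + dL y z = dL w z → ∃ a b c : ℝ≥0, dL w x = a ∧ dL x y = b ∧ dL y z = c := by
    intro w x y z h he
    have := ne_top_of_mem_zeroCycles hfin h
    rw [← he, ENNReal.add_ne_top, ENNReal.add_ne_top] at this
    exact ⟨_, _, _, (ENNReal.coe_toNNReal this.1.1).symm, (ENNReal.coe_toNNReal this.1.2).symm,
      (ENNReal.coe_toNNReal this.2).symm⟩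
  have key : ∀ {x y x' : X}, (x, y) ∈ orientedRays dL Γ → (y, x') ∈ orientedRays dL Γ →
      (x, x') ∈ orientedRays dL Γ ∧ dL x x' = dL x y + dL y x' := by
    rintro x y x' ⟨⟨w, z⟩, h, he⟩ ⟨⟨w', z'⟩, h', he'⟩
    simp only at he he'
    obtain ⟨a, b, c, ha, hb, hc⟩ := hlift h he
    obtain ⟨a', b', c', ha', hb', hc'⟩ := hlift h' he'
    have i1 : dL w' z ≤ a' + c := by rw [← ha', ← hc]; exact hdL.triangle _ _ _
    have i2 : dL x x' ≤ b + b' := by rw [← hb, ← hb']; exact hdL.triangle _ _ _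
    have i3 : dL w z' ≤ a + dL x x' + c' := by
      rw [← ha, ← hc']
      exact (hdL.triangle _ x' _).trans (add_le_add_left (hdL.triangle _ _ _) _)
    have i4 : dL w z' ≤ a + (b + b') + c' := i3.trans (by gcongr)
    -- Exchanging end points does not raise the cost: `w' → z` and `w → z'` can both be routed
    -- through `y`, using the same segments in total. Splicing yields equality, so each triangle
    -- inequality used is an equality (`k1`, `k2`).
    obtain ⟨h1, h2⟩ := zeroCycles_splice hmono hfin h h' (by
      rw [← he, ← he', ha, hb, hc, ha', hb', hc']
      refine (add_le_add i1 i4).trans_eq ?_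
      ring)
    have lift : ∀ {r q : ℝ≥0∞}, q ≠ ∞ → r ≤ q → ∃ c : ℝ≥0, r = c := fun hq hr =>
      ⟨_, (ENNReal.coe_toNNReal (ne_top_of_le_ne_top hq hr)).symm⟩
    obtain ⟨d, hd⟩ := lift (by finiteness) i1
    obtain ⟨e, he1⟩ := lift (by finiteness) i2
    obtain ⟨g, hg⟩ := lift (by finiteness) i4
    rw [← he, ← he', hd, hg, ha, hb, hc, ha', hb', hc'] at h2
    rw [hd] at i1
    rw [he1] at i2
    rw [hg, he1] at i3
    have j1 : (d : ℝ) ≤ a' + c := by exact_mod_cast i1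
    have j2 : (e : ℝ) ≤ b + b' := by exact_mod_cast i2
    have j3 : (g : ℝ) ≤ a + e + c' := by exact_mod_cast i3
    have j4 : (d : ℝ) + g = a + b + c + (a' + b' + c') := by exact_mod_cast h2
    have k1 : (e : ℝ) = b + b' := by linarith
    have k2 : (a : ℝ) + e + c' = g := by linarith
    refine ⟨⟨(w, z'), h1, ?_⟩, ?_⟩
    · simp only
      rw [ha, he1, hc', hg]
      exact_mod_cast k2
    · rw [he1, hb, hb']
      exact_mod_cast k1
  refine ⟨?_, fun h h' => (key h h').1, fun h h' => (key h h').2, ?_⟩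
  · rintro x y ⟨⟨w, z⟩, h, he⟩
    obtain ⟨a, b, c, ha, hb, hc⟩ := hlift h he
    simp [hb]
  · rintro x y z ⟨⟨w, v⟩, h, he⟩ hxyz
    simp only at he
    rw [← hxyz] at he
    refine ⟨⟨(w, v), h, le_antisymm ?_ ?_⟩, ⟨(w, v), h, le_antisymm ?_ ?_⟩⟩ <;> simp only
    · calc dL w x + dL x y + dL y v ≤ dL w x + dL x y + (dL y z + dL z v) := by
            gcongr; exact hdL.triangle _ _ _
        _ = dL w v := by rw [← he]; ring
    · exact (hdL.triangle _ y _).trans (by gcongr; exact hdL.triangle _ _ _)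
    · calc dL w y + dL y z + dL z v ≤ dL w x + dL x y + dL y z + dL z v := by
            gcongr; exact hdL.triangle _ _ _
        _ = dL w v := by rw [← he]; ring
    · exact (hdL.triangle _ z _).trans (by gcongr; exact hdL.triangle _ _ _)

/-- This replaces the translation by a condition free of the base set `S`. When both points lie on
the same side of the base point, they are ordered because that point is interior. -/
theorem mem_orientedRays_of_mem_evolution (hdL : GeodesicStructure dL)
    (hG : IsRayOrder dL (orientedRays dL Γ)) {S A : Set X} (hS : S ⊆ transportSet dL Γ) {t : ℝ}
    (ht : 0 < t) {x' : X} (hx' : x' ∈ evolution dL Γ S A t) :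
    ∃ x ∈ A, (x, x') ∈ orientedRays dL Γ ∧ dL x x' = ENNReal.ofReal t := by
  obtain ⟨y, s, x, hxA, h, h'⟩ := hx'
  refine ⟨x, hxA, ?_⟩
  have hcancel : ∀ {a b : ℝ} {c : ℝ≥0∞}, 0 ≤ a → 0 ≤ b →
      ENNReal.ofReal (a + b) = ENNReal.ofReal a + c → c = ENNReal.ofReal b := by
    intro a b c ha hb h
    rw [ENNReal.ofReal_add ha hb] at h
    exact ((ENNReal.add_right_inj ENNReal.ofReal_ne_top).1 h).symm
  rcases h with ⟨hy, hs, hyx, hd⟩ | ⟨hy, hs, hyx, hd⟩ <;>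
    rcases h' with ⟨-, hs', hyx', hd'⟩ | ⟨-, hs', hyx', hd'⟩ <;>
    simp only at hy hs hyx hd hs' hyx' hd'
  · obtain ⟨⟨p, hp, hne⟩, -⟩ := hS hy
    rw [hdL.symm] at hd hd'
    have hmem := hG.mem_of_common_source hdL hp hne hyx hyx' (by
      rw [hd, hd']; exact ENNReal.ofReal_le_ofReal (by linarith))
    refine ⟨hmem, hcancel hs ht.le ?_⟩
    rw [← hd, ← hd', hG.add hyx hmem]
  · linarith
  · refine ⟨hG.trans hyx hyx', ?_⟩
    rw [hdL.symm] at hd'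
    rw [hG.add hyx hyx', hd, hd', ← ENNReal.ofReal_add (by linarith) hs']
    congr 1
    ring
  · obtain ⟨-, ⟨p, hp, hne⟩⟩ := hS hy
    have hmem := hG.mem_of_common_target hdL hp hne hyx' hyx (by
      rw [hd, hd']; exact ENNReal.ofReal_le_ofReal (by linarith))
    refine ⟨hmem, hcancel (a := -(s + t)) (by linarith) ht.le ?_⟩
    rw [← hd', add_comm (dL x' y), ← hG.add hmem hyx', hd]
    congr 1
    ring

end OrientedRays

/-! ### Analyticity of the ray relations. -/

section Analytic

variable {X : Type*} [MetricSpace X] [CompleteSpace X] [SecondCountableTopology X]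
  [MeasurableSpace X] [BorelSpace X] {dL : X → X → ℝ≥0∞} {Γ G : Set (X × X)}

theorem analyticSet_zeroCycles (hdL : Measurable fun p : X × X => dL p.1 p.2)
    (hΓ : MeasurableSet Γ) : AnalyticSet (zeroCycles dL Γ) := by
  have : zeroCycles dL Γ = ⋃ n : ℕ,
      (fun p : (Fin (n + 1) → X) × (Fin (n + 1) → X) => (p.1 0, p.2 (Fin.last n))) ''
        {p | (∀ i, (p.1 i, p.2 i) ∈ Γ) ∧
          ∑ i, dL (p.1 (i + 1)) (p.2 i) = ∑ i, dL (p.1 i) (p.2 i)} := by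
    ext ⟨x, y⟩
    simp only [mem_iUnion]
    constructor
    · rintro ⟨n, w, z, h1, h2, h3, h4⟩
      exact ⟨n, (w, z), ⟨h1, h4⟩, Prod.ext h2 h3⟩
    · rintro ⟨n, ⟨w, z⟩, ⟨h1, h4⟩, h⟩
      exact ⟨n, w, z, h1, congrArg Prod.fst h, congrArg Prod.snd h, h4⟩
  rw [this]
  refine AnalyticSet.iUnion fun n => MeasurableSet.analyticSet_image ?_ (by fun_prop)
  have hd : ∀ i j : Fin (n + 1),
      Measurable fun p : (Fin (n + 1) → X) × (Fin (n + 1) → X) => dL (p.1 i) (p.2 j) := fun i j =>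
    hdL.comp (f := fun p : (Fin (n + 1) → X) × (Fin (n + 1) → X) => (p.1 i, p.2 j)) (by fun_prop)
  have hmem : MeasurableSet
      {p : (Fin (n + 1) → X) × (Fin (n + 1) → X) | ∀ i, (p.1 i, p.2 i) ∈ Γ} := by
    simp only [ofPred_forall]
    exact MeasurableSet.iInter fun i =>
      hΓ.preimage (f := fun p : (Fin (n + 1) → X) × (Fin (n + 1) → X) => (p.1 i, p.2 i))
        (by fun_prop)
  exact hmem.inter (measurableSet_eq_fun
    (Finset.measurable_sum _ fun i _ => hd _ _) (Finset.measurable_sum _ fun i _ => hd _ _))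

theorem analyticSet_orientedRays (hdL : Measurable fun p : X × X => dL p.1 p.2)
    (hΓ : MeasurableSet Γ) : AnalyticSet (orientedRays dL Γ) := by
  have : orientedRays dL Γ = Prod.fst '' ((Prod.snd : (X × X) × (X × X) → X × X) ⁻¹'
      zeroCycles dL Γ ∩
      {p | dL p.2.1 p.1.1 + dL p.1.1 p.1.2 + dL p.1.2 p.2.2 = dL p.2.1 p.2.2}) := by
    ext p
    constructor
    · rintro ⟨q, hq, h⟩
      exact ⟨(p, q), ⟨hq, h⟩, rfl⟩
    · rintro ⟨⟨p, q⟩, ⟨hq, h⟩, rfl⟩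
      exact ⟨q, hq, h⟩
  rw [this]
  refine AnalyticSet.image_of_continuous (AnalyticSet.inter ?_ (MeasurableSet.analyticSet ?_))
    continuous_fst
  · exact (analyticSet_zeroCycles hdL hΓ).preimage continuous_snd
  · have hd : ∀ {f g : (X × X) × (X × X) → X}, Measurable f → Measurable g →
        Measurable fun p => dL (f p) (g p) := fun hf hg => hdL.comp (hf.prodMk hg)
    exact measurableSet_eq_fun
      (((hd (by fun_prop) (by fun_prop)).add (hd (by fun_prop) (by fun_prop))).add
        (hd (by fun_prop) (by fun_prop))) (hd (by fun_prop) (by fun_prop))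

theorem analyticSet_strict (hG : AnalyticSet G) : AnalyticSet (G ∩ {p | p.1 ≠ p.2}) :=
  hG.inter (IsOpen.measurableSet
    (isOpen_ne_fun continuous_fst continuous_snd)).analyticSet

theorem analyticSet_hasPred (hG : AnalyticSet G) :
    AnalyticSet {x | ∃ y, (y, x) ∈ G ∧ y ≠ x} := by
  convert (analyticSet_strict hG).image_of_continuous continuous_snd using 1
  ext x
  simp [and_assoc]

theorem analyticSet_hasSucc (hG : AnalyticSet G) :
    AnalyticSet {x | ∃ y, (x, y) ∈ G ∧ y ≠ x} := by
  convert (analyticSet_strict hG).image_of_continuous continuous_fst using 1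
  ext x
  simp [and_assoc, eq_comm]

theorem analyticSet_rayInterior (hG : AnalyticSet G) : AnalyticSet (rayInterior G) :=
  (analyticSet_hasPred hG).inter (analyticSet_hasSucc hG)

omit [MeasurableSpace X] [BorelSpace X] in
/-- The points comparable with `A` form an analytic set if `A` is analytic. -/
theorem analyticSet_comparable (hG : AnalyticSet G) {A : Set X} (hA : AnalyticSet A) :
    AnalyticSet {x | ∃ z ∈ A, (x, z) ∈ G ∨ (z, x) ∈ G} := by
  have h1 : AnalyticSet (G ∪ Prod.swap ⁻¹' G) := hG.union (hG.preimage continuous_swap)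
  convert (h1.inter (hA.preimage continuous_snd)).image_of_continuous continuous_fst using 1
  ext x
  simp [and_comm]

end Analytic

/-! ### Construction of the cross section. -/

section CrossSection

variable {X : Type*} [MetricSpace X] [CompleteSpace X] [SecondCountableTopology X]
  [MeasurableSpace X] [BorelSpace X] {dL : X → X → ℝ≥0∞} {G : Set (X × X)}

omit [CompleteSpace X] [BorelSpace X] in
/-- Around every interior point of a ray there is a ball, among countably many given ones, that has
closed intersection with the ray. -/
theorem IsRayOrder.exists_isClosed_openRay_inter (hG : IsRayOrder dL G)
    (hdL : GeodesicStructure dL) [Nonempty X] {x : X} (hx : x ∈ rayInterior G) :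
    ∃ i n : ℕ, (openRay G x ∩ Metric.closedBall (TopologicalSpace.denseSeq X i)
        (1 / ((n : ℝ) + 1))).Nonempty ∧
      IsClosed (openRay G x ∩ Metric.closedBall (TopologicalSpace.denseSeq X i)
        (1 / ((n : ℝ) + 1))) := by
  obtain ⟨r, hr, hc⟩ := hG.exists_isCompact_openRay_inter_closedBall hdL hx
  obtain ⟨n, hn⟩ := exists_nat_one_div_lt (half_pos hr)
  obtain ⟨i, hi⟩ := (TopologicalSpace.denseRange_denseSeq X).exists_dist_lt x
    (show (0 : ℝ) < 1 / ((n : ℝ) + 1) by positivity)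
  refine ⟨i, n, ⟨x, ?_, Metric.mem_closedBall.2 hi.le⟩, ?_⟩
  · obtain ⟨⟨p, hp, -⟩, -⟩ := id hx
    exact ⟨hx, Or.inl (hG.refl_right hdL hp)⟩
  · have hsub : Metric.closedBall (TopologicalSpace.denseSeq X i) (1 / ((n : ℝ) + 1)) ⊆
        Metric.closedBall x r := by
      refine Metric.closedBall_subset_closedBall' ?_
      rw [dist_comm]
      linarith
    rw [← inter_eq_right.2 hsub, ← inter_assoc]
    exact hc.isClosed.inter Metric.isClosed_closedBall

/-- The rays without end points have a measurable cross section. -/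
theorem IsRayOrder.exists_crossSection (hG : IsRayOrder dL G) (hdL : GeodesicStructure dL)
    (hGan : AnalyticSet G) (μ : Measure X) [IsFiniteMeasure μ] [Nonempty X] :
    ∃ f : X → X, AEMeasurable f μ ∧ (∀ x ∈ rayInterior G, f x ∈ openRay G x) ∧
      ∀ x y, openRay G x = openRay G y → f x = f y := by
  classical
  let B : ℕ → Set X := fun k => Metric.closedBall
    (TopologicalSpace.denseSeq X k.unpair.1) (1 / ((k.unpair.2 : ℝ) + 1))
  have hT := analyticSet_rayInterior hGan
  have hsel : ∀ k, ∃ f : NullMeasurableSpace X μ → X, Measurable f ∧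
      (∀ x, (openRay G x ∩ B k).Nonempty → f x ∈ closure (openRay G x ∩ B k)) ∧
      ∀ x y, openRay G x ∩ B k = openRay G y ∩ B k → f x = f y := by
    intro k
    -- The hitting sets are analytic, not necessarily Borel; passing to the completion of `μ` makes
    -- them measurable.
    refine exists_measurable_mem_closure (Ω := NullMeasurableSpace X μ)
      (fun x => openRay G x ∩ B k) fun A hA => ?_
    have h1 : AnalyticSet (rayInterior G ∩ B k ∩ A) :=
      (hT.inter (Metric.isClosed_closedBall.analyticSet)).inter hA
    have h2 : {x | (openRay G x ∩ B k ∩ A).Nonempty} =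
        {x | ∃ z ∈ rayInterior G ∩ B k ∩ A, (x, z) ∈ G ∨ (z, x) ∈ G} := by
      ext x
      constructor
      · rintro ⟨z, ⟨⟨hz, hxz⟩, hzB⟩, hzA⟩
        exact ⟨z, ⟨⟨hz, hzB⟩, hzA⟩, hxz⟩
      · rintro ⟨z, ⟨⟨hz, hzB⟩, hzA⟩, hxz⟩
        exact ⟨z, ⟨⟨hz, hxz⟩, hzB⟩, hzA⟩
    have h3 : NullMeasurableSet {x | (openRay G x ∩ B k ∩ A).Nonempty} μ := by
      rw [h2]
      exact (analyticSet_comparable hGan h1).nullMeasurableSet μ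
    exact h3
  choose F hFm hFc hFe using hsel
  have hFae : ∀ k, AEMeasurable (F k) μ := fun k =>
    NullMeasurable.aemeasurable (fun s hs => hFm k hs)
  -- The second alternative only keeps `Nat.find` total; it never occurs at an interior point.
  let p : ℕ → X → Prop := fun k x => F k x ∈ openRay G x ∨ ∀ j, F j x ∉ openRay G x
  have hp : ∀ x, ∃ k, p k x := by
    intro x
    by_cases h : ∃ k, F k x ∈ openRay G x
    · exact h.imp fun k hk => Or.inl hk
    · exact ⟨0, Or.inr (not_exists.1 h)⟩
  have hgood : ∀ k, NullMeasurableSet {x | F k x ∈ openRay G x} μ := by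
    intro k
    have h1 : AnalyticSet ((Prod.snd ⁻¹' rayInterior G) ∩ (G ∪ Prod.swap ⁻¹' G)) :=
      (hT.preimage continuous_snd).inter (hGan.union (hGan.preimage continuous_swap))
    exact h1.nullMeasurableSet_preimage (f := fun x => (x, F k x)) (aemeasurable_id.prodMk (hFae k))
  have hpm : ∀ k, NullMeasurableSet {x | p k x} μ := by
    intro k
    have : {x | p k x} = {x | F k x ∈ openRay G x} ∪ ⋂ j, {x | F j x ∈ openRay G x}ᶜ := by
      ext x
      simp [p]
    rw [this]
    exact (hgood k).union (NullMeasurableSet.iInter fun j => (hgood j).compl)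
  refine ⟨fun x => F (Nat.find (hp x)) x, ?_, ?_, ?_⟩
  · have : Measurable[NullMeasurableSpace.instMeasurableSpace (μ := μ)]
        (fun x : NullMeasurableSpace X μ => F (Nat.find (hp x)) x) :=
      Measurable.find hFm (fun k => hpm k) hp
    exact NullMeasurable.aemeasurable (fun s hs => this hs)
  · intro x hx
    rcases Nat.find_spec (hp x) with h | h
    · exact h
    · exfalso
      obtain ⟨i, n, hne, hcl⟩ := hG.exists_isClosed_openRay_inter hdL hx
      have hB : B (Nat.pair i n) = Metric.closedBall (TopologicalSpace.denseSeq X i)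
          (1 / ((n : ℝ) + 1)) := by simp [B]
      rw [← hB] at hne hcl
      have := hFc _ x hne
      rw [hcl.closure_eq] at this
      exact h _ this.1
  · intro x y h
    have hF : ∀ k, F k x = F k y := fun k => hFe k x y (by rw [h])
    have hpp : ∀ {k}, p k x ↔ p k y := by
      intro k
      simp only [p, hF, h]
    have hk : Nat.find (hp x) = Nat.find (hp y) := Nat.find_congr' hpp
    simp only [hF, hk]

end CrossSection

/-! ### Existence and uniqueness of strongly consistent disintegrations. -/

section Disintegration

open ProbabilityTheory

/-- Uniqueness of disintegrations with respect to a countably generated σ-algebra. -/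
theorem ae_eq_of_forall_setLIntegral_measure_eq {X Y : Type*} [MeasurableSpace X]
    [MeasurableSpace.CountablyGenerated X] [MeasurableSpace Y] {m : Measure Y} [SigmaFinite m]
    {κ η : Y → Measure X} [∀ y, IsFiniteMeasure (η y)]
    (hκ : ∀ B, MeasurableSet B → AEMeasurable (fun y => κ y B) m)
    (hη : ∀ B, MeasurableSet B → AEMeasurable (fun y => η y B) m)
    (h : ∀ B C, MeasurableSet B → MeasurableSet C → ∫⁻ y in C, κ y B ∂m = ∫⁻ y in C, η y B ∂m) :
    ∀ᵐ y ∂m, κ y = η y := by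
  set 𝒜 := generateSetAlgebra (MeasurableSpace.countableGeneratingSet X)
  have hcount : 𝒜.Countable :=
    countable_generateSetAlgebra MeasurableSpace.countable_countableGeneratingSet
  have halg : IsSetAlgebra 𝒜 := isSetAlgebra_generateSetAlgebra
  have hgen : ‹MeasurableSpace X› = MeasurableSpace.generateFrom 𝒜 := by
    rw [generateFrom_generateSetAlgebra_eq, MeasurableSpace.generateFrom_countableGeneratingSet]
  have hae : ∀ B, MeasurableSet B → ∀ᵐ y ∂m, κ y B = η y B := fun B hB =>
    ae_eq_of_forall_setLIntegral_eq_of_sigmaFinite₀ (hκ B hB) (hη B hB)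
      fun C hC _ => h B C hB hC
  have hall : ∀ᵐ y ∂m, ∀ B ∈ 𝒜, κ y B = η y B :=
    (ae_ball_iff hcount).2 fun B hB => hae B (by
      rw [hgen]; exact MeasurableSpace.measurableSet_generateFrom hB)
  filter_upwards [hall] with y hy
  refine (ext_of_generate_finite 𝒜 hgen ?_ (fun B hB => (hy B hB).symm) ?_).symm
  · exact fun s hs t ht _ => halg.inter_mem hs ht
  · exact (hy _ halg.univ_mem).symm

variable {X : Type*} [MetricSpace X] [CompleteSpace X] [SecondCountableTopology X]
  [MeasurableSpace X] [BorelSpace X] [Nonempty X] {μ : Measure X} [IsProbabilityMeasure μ]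
  {f : X → X}

theorem setLIntegral_condDistrib_id (hf : AEMeasurable f μ) {B C : Set X} (hB : MeasurableSet B)
    (hC : MeasurableSet C) :
    ∫⁻ y in C, condDistrib id f μ y B ∂(μ.map f) = μ (B ∩ f ⁻¹' C) := by
  rw [← Measure.compProd_apply_prod hC hB, compProd_map_condDistrib aemeasurable_id,
    Measure.map_apply_of_aemeasurable (hf.prodMk aemeasurable_id) (hC.prod hB)]
  congr 1
  ext x
  simp [and_comm]

theorem ae_condDistrib_id_of_ae {p : X × X → Prop} (hp : MeasurableSet {q | p q})
    (hf : AEMeasurable f μ) (h : ∀ᵐ x ∂μ, p (f x, x)) :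
    ∀ᵐ y ∂(μ.map f), ∀ᵐ x ∂(condDistrib id f μ y), p (y, x) := by
  rw [← Measure.ae_compProd_iff hp, compProd_map_condDistrib aemeasurable_id,
    ae_map_iff (hf.prodMk aemeasurable_id) hp]
  exact h

theorem ae_condDistrib_id_fiber (hf : AEMeasurable f μ) {T : Set X} (hT : ∀ᵐ x ∂μ, x ∈ T) :
    ∀ᵐ y ∂(μ.map f), condDistrib id f μ y (T ∩ f ⁻¹' {y})ᶜ = 0 := by
  have h1 : ∀ᵐ x ∂μ, x ∈ T ∧ f x = hf.mk f x := hT.and hf.ae_eq_mk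
  -- `T` and `f` are measurable only up to null sets, so the fibre condition is tested on a Borel
  -- conull set with the Borel version of `f`.
  obtain ⟨N, hN, hNm, hN0⟩ := exists_measurable_superset_of_null h1
  have h2 : ∀ᵐ x ∂μ, x ∈ Nᶜ ∧ hf.mk f x = f x :=
    (measure_eq_zero_iff_ae_notMem.1 hN0).and (hf.ae_eq_mk.symm)
  have h3 := ae_condDistrib_id_of_ae (p := fun q => q.2 ∈ Nᶜ ∧ hf.mk f q.2 = q.1)
    ((hNm.compl.preimage measurable_snd).inter
      (measurableSet_eq_fun (hf.measurable_mk.comp measurable_snd) measurable_fst)) hf h2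
  filter_upwards [h3] with y hy
  rw [measure_eq_zero_iff_ae_notMem]
  filter_upwards [hy] with x ⟨hxN, hxy⟩
  rw [notMem_compl_iff]
  have hxT : x ∈ T ∧ f x = hf.mk f x := by
    by_contra h
    exact hxN (hN h)
  exact ⟨hxT.1, hxT.2.trans hxy⟩

/-- Existence of a strongly consistent disintegration with respect to an idempotent map. -/
theorem exists_isDisintegration (hf : AEMeasurable f μ) {T : Set X} (hT : ∀ᵐ x ∂μ, x ∈ T)
    (hfT : ∀ x ∈ T, f x ∈ T) (hff : ∀ x ∈ T, f (f x) = f x) :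
    ∃ κ : X → Measure X, IsDisintegration μ T f κ := by
  classical
  let η := condDistrib id f μ
  -- Concentration is required at every `y ∈ f '' T`. On the exceptional null set the Dirac mass
  -- works, because such a `y` satisfies `y ∈ T` and `f y = y`.
  let κ : X → Measure X := fun y =>
    if η y (T ∩ f ⁻¹' {y})ᶜ = 0 then η y else Measure.dirac y
  have hκη : ∀ᵐ y ∂(μ.map f), κ y = η y := by
    filter_upwards [ae_condDistrib_id_fiber hf hT] with y hy
    exact if_pos hy
  refine ⟨κ, fun y _ => ?_, fun B hB => ?_, fun B C hB hC => ?_, ?_⟩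
  · by_cases h : η y (T ∩ f ⁻¹' {y})ᶜ = 0
    · simp only [κ, if_pos h]; infer_instance
    · simp only [κ, if_neg h]; infer_instance
  · refine (η.measurable_coe hB).aemeasurable.congr ?_
    filter_upwards [hκη] with y hy
    rw [hy]
  · rw [← setLIntegral_condDistrib_id hf hB hC]
    refine lintegral_congr_ae (ae_restrict_of_ae ?_)
    filter_upwards [hκη] with y hy
    rw [hy]
  · rintro _ ⟨x, hx, rfl⟩
    by_cases h : η (f x) (T ∩ f ⁻¹' {f x})ᶜ = 0
    · simp only [κ, if_pos h]; exact h
    · simp only [κ, if_neg h]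
      rw [Measure.dirac_apply]
      have hmem : f x ∈ T ∩ f ⁻¹' {f x} := ⟨hfT x hx, hff x hx⟩
      exact indicator_of_notMem (notMem_compl_iff.2 hmem) _

theorem IsDisintegration.ae_eq_condDistrib {T : Set X} {κ : X → Measure X}
    (hκ : IsDisintegration μ T f κ) (hf : AEMeasurable f μ) :
    ∀ᵐ y ∂(μ.map f), κ y = condDistrib id f μ y := by
  have := Measure.isProbabilityMeasure_map hf
  refine ae_eq_of_forall_setLIntegral_measure_eq hκ.aemeasurable
    (fun B hB => (Kernel.measurable_coe _ hB).aemeasurable) fun B C hB hC => ?_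
  rw [← hκ.consistent B C hB hC, setLIntegral_condDistrib_id hf hB hC]

omit [Nonempty X] in
theorem measurable_kernel_singleton (η : Kernel X X) [IsFiniteKernel η] :
    Measurable fun p : X × X => η p.1 {p.2} := by
  have h := Kernel.measurable_kernel_prodMk_left (κ := η.comap Prod.fst measurable_fst)
    (t := {q : (X × X) × X | q.2 = q.1.2})
    (measurableSet_eq_fun measurable_snd (measurable_snd.comp measurable_fst))
  exact h

end Disintegration

/-! ### Negligible sets obtained from translation along the rays. -/

section Evolution

open ProbabilityTheory

variable {X : Type*} [MetricSpace X] [CompleteSpace X] [SecondCountableTopology X]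
  [MeasurableSpace X] [BorelSpace X] {dL : X → X → ℝ≥0∞} {Γ : Set (X × X)} {μ : Measure X}
  [IsProbabilityMeasure μ] {S : Set X}

theorem analyticSet_translate (hdL : Measurable fun p : X × X => dL p.1 p.2) {G : Set (X × X)}
    (hG : AnalyticSet G) {A : Set X} (hA : MeasurableSet A) (c : ℝ≥0∞) :
    AnalyticSet {x' | ∃ x ∈ A, (x, x') ∈ G ∧ dL x x' = c} := by
  have h1 : MeasurableSet (Prod.fst ⁻¹' A ∩ {p : X × X | dL p.1 p.2 = c}) :=
    (hA.preimage measurable_fst).inter (measurableSet_eq_fun hdL measurable_const)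
  convert (hG.inter h1.analyticSet).image_of_continuous continuous_snd using 1
  ext x
  simp only [mem_ofPred_eq, mem_image, mem_inter_iff, mem_preimage, Prod.exists]
  constructor
  · rintro ⟨a, ha, h, hd⟩
    exact ⟨a, x, ⟨h, ha, hd⟩, rfl⟩
  · rintro ⟨a, _, ⟨h, ha, hd⟩, rfl⟩
    exact ⟨a, ha, h, hd⟩

/-- If translation along the rays spreads out every set of positive measure, then a set that hits
almost every point at boundedly many times is negligible. -/
theorem measure_eq_zero_of_card_le (hdL : GeodesicStructure dL)
    (hG : IsRayOrder dL (orientedRays dL Γ)) (hGan : AnalyticSet (orientedRays dL Γ))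
    (hS : S ⊆ transportSet dL Γ)
    (H : ∀ A : Set X, MeasurableSet A → 0 < μ A →
      ¬ {t : ℝ | 0 < t ∧ 0 < μ (evolution dL Γ S A t)}.Countable)
    {A : Set X} (hA : NullMeasurableSet A μ) (N : ℕ)
    (hN : ∀ᵐ x' ∂μ, ∀ F : Finset ℝ, (∀ t ∈ F, 0 < t ∧ ∃ x ∈ A, (x, x') ∈ orientedRays dL Γ ∧
      dL x x' = ENNReal.ofReal t) → F.card ≤ N) : μ A = 0 := by
  obtain ⟨A', hA'A, hA'm, hA'e⟩ := hA.exists_measurable_subset_ae_eq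
  rw [← measure_congr hA'e]
  by_contra h0
  refine H A' hA'm (pos_iff_ne_zero.2 h0) ?_
  let E : ℝ → Set X := fun t => {x' | 0 < t ∧ ∃ x ∈ A', (x, x') ∈ orientedRays dL Γ ∧
    dL x x' = ENNReal.ofReal t}
  have hE : ∀ t, NullMeasurableSet (E t) μ := by
    intro t
    by_cases ht : 0 < t
    · simp only [E, ht, true_and]
      exact (analyticSet_translate hdL.borel hGan hA'm _).nullMeasurableSet μ
    · simp [E, ht]
  refine (countable_measure_pos_of_card_le hE N ?_).mono ?_
  · filter_upwards [hN] with x' hx' F hF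
    refine hx' F fun t ht => ?_
    obtain ⟨h1, x, hx, h2⟩ := hF t ht
    exact ⟨h1, x, hA'A hx, h2⟩
  · rintro t ⟨ht, hpos⟩
    exact hpos.trans_le
      (measure_mono fun x' hx' => ⟨ht, mem_orientedRays_of_mem_evolution hdL hG hS ht hx'⟩)

/-- Almost every point has a strict successor and a strict predecessor. -/
theorem ae_hasSucc_and_hasPred (hdL : GeodesicStructure dL)
    (hG : IsRayOrder dL (orientedRays dL Γ)) (hGan : AnalyticSet (orientedRays dL Γ))
    (hS : S ⊆ transportSet dL Γ)
    (H : ∀ A : Set X, MeasurableSet A → 0 < μ A →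
      ¬ {t : ℝ | 0 < t ∧ 0 < μ (evolution dL Γ S A t)}.Countable) :
    (∀ᵐ x ∂μ, ∃ y, (x, y) ∈ orientedRays dL Γ ∧ y ≠ x) ∧
      ∀ᵐ x ∂μ, ∃ y, (y, x) ∈ orientedRays dL Γ ∧ y ≠ x := by
  have hne : ∀ {x x' : X} {t : ℝ}, 0 < t → dL x x' = ENNReal.ofReal t → x ≠ x' := by
    rintro x _ t ht h rfl
    rw [hdL.self, eq_comm, ENNReal.ofReal_eq_zero] at h
    linarith
  have hsucc : ∀ᵐ x ∂μ, ∃ y, (x, y) ∈ orientedRays dL Γ ∧ y ≠ x := by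
    refine measure_eq_zero_of_card_le hdL hG hGan hS H
      ((analyticSet_hasSucc hGan).nullMeasurableSet μ).compl 0
      (Filter.Eventually.of_forall fun x' F hF => ?_)
    rw [Nat.le_zero, Finset.card_eq_zero, Finset.eq_empty_iff_forall_notMem]
    intro t ht
    obtain ⟨ht0, x, hx, hxx', hd⟩ := hF t ht
    exact hx ⟨x', hxx', (hne ht0 hd).symm⟩
  refine ⟨hsucc, measure_eq_zero_of_card_le hdL hG hGan hS H
      ((analyticSet_hasPred hGan).nullMeasurableSet μ).compl 1 ?_⟩
  filter_upwards [hsucc] with x' ⟨z, hz, hzne⟩ F hF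
  rw [Finset.card_le_one]
  intro s hs t ht
  obtain ⟨hs0, a, ha, hax', hda⟩ := hF s hs
  obtain ⟨ht0, b, hb, hbx', hdb⟩ := hF t ht
  -- Since `x'` has a successor, `a` and `b` are comparable; if distinct, the later one would have a
  -- predecessor.
  have hab : a = b := by
    by_contra hab
    rcases hG.comparable_of_common_target hdL hz hzne hax' hbx' with h | h
    · exact hb ⟨a, h, hab⟩
    · exact ha ⟨b, h, fun h' => hab h'.symm⟩
  subst hab
  rwa [hda, ENNReal.ofReal_eq_ofReal_iff hs0.le ht0.le] at hdb

/-- The conditional probabilities along the rays have no atoms. -/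
theorem ae_condDistrib_noAtoms [Nonempty X] (hdL : GeodesicStructure dL)
    (hG : IsRayOrder dL (orientedRays dL Γ)) (hGan : AnalyticSet (orientedRays dL Γ))
    {f : X → X} (hf : IsCrossSection dL Γ μ f)
    (H : ∀ A : Set X, MeasurableSet A → 0 < μ A →
      ¬ {t : ℝ | 0 < t ∧ 0 < μ (evolution dL Γ (f '' transportSet dL Γ) A t)}.Countable)
    (hT : ∀ᵐ x ∂μ, x ∈ transportSet dL Γ) :
    ∀ᵐ y ∂(μ.map f), ∀ x : X, condDistrib id f μ y {x} = 0 := by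
  set η := condDistrib id f μ
  have hS : f '' transportSet dL Γ ⊆ transportSet dL Γ := by
    rintro _ ⟨x, hx, rfl⟩
    exact hf.mem x hx
  have hηm : AEMeasurable (fun x => η (f x) {x}) μ :=
    (measurable_kernel_singleton η).comp_aemeasurable (hf.aemeasurable.prodMk aemeasurable_id)
  have hnull : ∀ n : ℕ, μ {x | x ∈ transportSet dL Γ ∧
      ((n : ℝ≥0∞) + 1)⁻¹ < η (f x) {x}} = 0 := by
    intro n
    refine measure_eq_zero_of_card_le hdL hG hGan hS H (NullMeasurableSet.inter
      ((analyticSet_rayInterior hGan).nullMeasurableSet μ)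
      (hηm.nullMeasurable measurableSet_Ioi)) (n + 1) ?_
    filter_upwards [hT] with x' hx' F hF
    choose! a ha using fun t ht => (hF t ht).2
    -- All the points `a t` lie on the ray of `x'`, hence are atoms of the single probability
    -- measure `η (f x')`, which bounds their number.
    have hfa : ∀ t ∈ F, f (a t) = f x' := fun t ht =>
      hf.eq_of_rays _ (ha t ht).1.1 _ hx' (Or.inl (ha t ht).2.1)
    have hinj : InjOn a F := by
      intro s hs t ht hst
      have hds := (ha s hs).2.2
      rw [hst, (ha t ht).2.2,
        ENNReal.ofReal_eq_ofReal_iff (hF t ht).1.le (hF s hs).1.le] at hds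
      exact hds.symm
    have hsum : ∑ t ∈ F, η (f x') {a t} ≤ 1 := by
      rw [← measure_biUnion_finset (f := fun t => {a t}) (fun s hs t ht hst =>
        disjoint_singleton.2 fun h => hst (hinj hs ht h)) fun t _ => measurableSet_singleton _]
      exact prob_le_one
    have hle : (F.card : ℝ≥0∞) * ((n : ℝ≥0∞) + 1)⁻¹ ≤ 1 := by
      rw [← nsmul_eq_mul]
      refine (Finset.card_nsmul_le_sum F _ _ fun t ht => ?_).trans hsum
      rw [← hfa t ht]
      exact (ha t ht).1.2.le
    rw [← div_eq_mul_inv, ENNReal.div_le_iff (by simp) (by finiteness), one_mul] at hle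
    exact_mod_cast hle
  have hzero : ∀ᵐ x ∂μ, η (f x) {x} = 0 := by
    have hall : ∀ᵐ x ∂μ, ∀ n : ℕ, ¬ (x ∈ transportSet dL Γ ∧
        ((n : ℝ≥0∞) + 1)⁻¹ < η (f x) {x}) :=
      ae_all_iff.2 fun n => measure_eq_zero_iff_ae_notMem.1 (hnull n)
    filter_upwards [hall, hT] with x hx hxT
    by_contra h0
    obtain ⟨n, hn⟩ := ENNReal.exists_inv_nat_lt h0
    refine hx n ⟨hxT, lt_of_le_of_lt (ENNReal.inv_le_inv.2 ?_) hn⟩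
    exact le_self_add
  have hfib := ae_condDistrib_id_of_ae (p := fun q => η q.1 {q.2} = 0)
    (measurableSet_eq_fun (measurable_kernel_singleton η) measurable_const) hf.aemeasurable hzero
  filter_upwards [hfib] with y hy x
  by_contra h0
  -- An atom would be contained in the set of points of positive mass, which is null for `η y`.
  refine h0 (measure_mono_null ?_ hy)
  rintro _ rfl
  exact h0

end Evolution

/-! ### Conclusion. -/

theorem theorem1p1 {X : Type*} [MetricSpace X] [CompleteSpace X] [SecondCountableTopology X]
    [MeasurableSpace X] [BorelSpace X]
    (dL : X → X → ℝ≥0∞) (hdL : GeodesicStructure dL)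
    (μ ν : Measure X) [IsProbabilityMeasure μ] [IsProbabilityMeasure ν]
    (π : Measure (X × X)) (hπ : IsTransferencePlan μ ν π)
    (Γ : Set (X × X)) (hΓ : IsMonotoneCarrier dL π Γ) :
    (∃ f : X → X, IsCrossSection dL Γ μ f) ∧
    ∀ f : X → X, IsCrossSection dL Γ μ f →
      (∀ A : Set X, MeasurableSet A → 0 < μ A →
        ¬ {t : ℝ | 0 < t ∧ 0 < μ (evolution dL Γ (f '' transportSet dL Γ) A t)}.Countable) →
      μ (transportSetWithEnds dL Γ \ transportSet dL Γ) = 0 ∧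
      μ (initialPoints dL Γ ∪ finalPoints dL Γ) = 0 ∧
      (∃ κ : X → Measure X, IsDisintegration μ (transportSet dL Γ) f κ) ∧
      ∀ κ : X → Measure X, IsDisintegration μ (transportSet dL Γ) f κ →
        ∀ᵐ y ∂(μ.map f), ∀ x : X, κ y {x} = 0 := by
  have : Nonempty X := nonempty_of_isProbabilityMeasure μ
  have hG := isRayOrder_orientedRays hdL hΓ.cyclicallyMonotone hΓ.finite
  have hGan := analyticSet_orientedRays (dL := dL) hdL.borel hΓ.borel
  constructor
  · obtain ⟨f, hfm, hf, hfe⟩ := hG.exists_crossSection hdL hGan μ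
    exact ⟨f, hfm, fun x hx => (hf x hx).1, fun x hx => (hf x hx).2,
      fun x hx y hy hxy => hfe x y (hG.openRay_eq hdL hx hy hxy)⟩
  intro f hf H
  have hS : f '' transportSet dL Γ ⊆ transportSet dL Γ := by
    rintro _ ⟨x, hx, rfl⟩
    exact hf.mem x hx
  obtain ⟨hsucc, hpred⟩ := ae_hasSucc_and_hasPred hdL hG hGan hS H
  have hT : ∀ᵐ x ∂μ, x ∈ transportSet dL Γ := hpred.and hsucc
  refine ⟨?_, ?_, ?_, fun κ hκ => ?_⟩
  · rw [measure_eq_zero_iff_ae_notMem]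
    filter_upwards [hT] with x hx h
    exact h.2 hx
  · rw [measure_eq_zero_iff_ae_notMem]
    filter_upwards [hpred, hsucc] with x ⟨p, hp, hpne⟩ ⟨q, hq, hqne⟩ h
    rcases h with ⟨⟨_, _⟩, ⟨-, h⟩, rfl⟩ | ⟨⟨_, _⟩, ⟨-, h⟩, rfl⟩
    · exact (h.subset ⟨hp, hpne⟩).elim
    · exact (h.subset ⟨hq, hqne⟩).elim
  · refine exists_isDisintegration hf.aemeasurable hT hf.mem fun x hx => ?_
    exact (hf.eq_of_rays x hx _ (hf.mem x hx) (hf.mem_rays x hx)).symm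
  · filter_upwards [hκ.ae_eq_condDistrib hf.aemeasurable,
      ae_condDistrib_noAtoms hdL hG hGan hf H hT] with y hy h x
    rw [hy, h x]
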